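/- For integers $m,r\ge 0$ let $RM(r,m)\subseteq\mathbb F_2^{N}$, $N=2^m$, be the binary Reed–Muller code, i.e. the linear code formed by the evaluation vectors, on all points of $\mathbb F_2^m$, of the polynomials of degree at most $r$ in $m$ variables over $\mathbb F_2$. The rate of a binary linear code $C\subseteq\mathbb F_2^N$ is $R(C)=\dim(C)/N$. For $0\le p\le 1$, the channel $\mathrm{BSC}(p)$ flips each transmitted bit independently with probability $p$. Let $0<R<1$ and $0\le p\le 1$ satisfy $$R<1-\log_2\!\left(1+\sqrt{4p(1-p)}\right).$$ Let $C_n=RM(r_n,m_n)$, $n\in\mathbb N$, be a family of binary Reed–Muller codes whose lengths $2^{m_n}$ tend to infinity, with $\limsup_{n\to\infty}R(C_n)\le R$. Then $\{C_n\}_n$ attains vanishing error probability on $\mathrm{BSC}(p)$: there are maximum likelihood decoders $D_n:\mathbb F_2^{2^{m_n}}\to C_n$ (that is, for every received word $y$, the codeword $D_n(y)$ maximizes over $c\in C_n$ the probability that $\mathrm{BSC}(p)$ outputs $y$ on input $c$) such that $$\max_{c\in C_n}\Pr\bigl[D_n(Y)\neq c \;\big|\; c\text{ is transmitted over }\mathrm{BSC}(p)\text{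 and }Y\text{ is received}\bigr]\longrightarrow 0\qquad(n\to\infty).$$ -/

import Mathlib

open Filter Topology

noncomputable section

/-- The binary Reed–Muller code `RM(r, m)`, of length `2 ^ m`: the evaluation vectors, on all points
of `𝔽₂ ^ m`, of the polynomials in `m` variables over `𝔽₂` of total degree at most `r`. -/
def reedMuller (m r : ℕ) : Submodule (ZMod 2) ((Fin m → ZMod 2) → ZMod 2) :=
  (MvPolynomial.restrictTotalDegree (Fin m) (ZMod 2) r).map
    (MvPolynomial.evalₗ (ZMod 2) (Fin m))

/-- The rate `dim C / n` of a binary linear code `C` of length `n`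
(coordinates are indexed by a finite type of size `n`). -/
def codeRate {ι : Type*} [Fintype ι] (C : Submodule (ZMod 2) (ι → ZMod 2)) : ℝ :=
  (Module.finrank (ZMod 2) C : ℝ) / (Fintype.card ι : ℝ)

/-- The probability that the binary symmetric channel `BSC(p)` outputs `y` on input `x`: each bit
is flipped, independently, with probability `p`. -/
def bscProb {ι : Type*} [Fintype ι] (p : ℝ) (x y : ι → ZMod 2) : ℝ :=
  ∏ i, if y i = x i then 1 - p else p

/-- The decoder `D` for `C` is a maximum likelihood decoder on `BSC(p)`
(equivalently, a block-MAP decoder for a uniformly distributed transmitted codeword). -/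
def IsMLDecoder {ι : Type*} [Fintype ι] (p : ℝ) (C : Submodule (ZMod 2) (ι → ZMod 2))
    (D : (ι → ZMod 2) → C) : Prop :=
  ∀ (y : ι → ZMod 2) (c : C), bscProb p (c : ι → ZMod 2) y ≤ bscProb p (D y : ι → ZMod 2) y

/-- The probability that `D` fails to recover the codeword `c` transmitted over `BSC(p)`. -/
def decodingErrorProb {ι : Type*} [Fintype ι] [DecidableEq ι] (p : ℝ)
    (C : Submodule (ZMod 2) (ι → ZMod 2)) (D : (ι → ZMod 2) → C) (c : C) : ℝ :=
  ∑ y with D y ≠ c, bscProb p (c : ι → ZMod 2) y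

/-- The block error probability of the decoder `D` on `BSC(p)`, for the worst transmitted
codeword. -/
def blockErrorProb {ι : Type*} [Fintype ι] [DecidableEq ι] (p : ℝ)
    (C : Submodule (ZMod 2) (ι → ZMod 2)) (D : (ι → ZMod 2) → C) : ℝ :=
  ⨆ c : C, decodingErrorProb p C D c

end

/-! Let W(z) = ∑ z^(weight of c) over the codewords. The union bound with Bhattacharyya coefficients
(`blockErrorProb_le`) bounds the error probability by W(z) - 1 at z = √(4p(1-p)), so it suffices
that W(z) → 1 for every z with log₂(1+z) < 1 - R. Two estimates of W, for heavy and for light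
codewords, are combined.

Heavy words: comparison with the erasure channel. As a function of one variable per coordinate, W is
multi-affine and nonnegative on [-1,1]^N. Hence switching a variable from 0 to 1 multiplies W by
some t in [1,2], and concavity of t^e with 2^e = 1+z gives log₂ W(z) ≤ E dim C_S, where S is a
random erasure pattern of density e and C_S the subcode supported on S
(`logb_weightEnum_le_biasedExp`). By Russo's formula the derivative of this mean dimension in e is N
times the probability h(e) that a given coordinate is not recoverable. Since h is monotone and its
integral is the rate, h stays away from 1 at densities below 1 - R. Reed–Muller codes are doubly
transitive, so all influences on h other than that of the coordinate itself are equal, and a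
Kahn–Kalai–Linial inequality forces a sharp threshold (`biasedExp_erasureFail_le`). Its width is of
order 1/m, so at fixed distance below the threshold h ≤ exp(-cm), whence W(z₁) ≤ 2^(N exp(-cm))
(`eventually_weightEnum_le`). Passing from z₁ to a smaller z gains exp(-βw) on words of weight w,
which beats this bound once w > N exp(-cm/2).

Light words: a word of weight at most 2^(m-l-5) is the pointwise majority of m+1 of its l-fold
derivatives in suitable directions, and these derivatives lie in a small space
(`card_lowWeight_le`). A code of rate bounded away from 1 has order at most about m/2, so a Chernoff
bound gives at most 2^(ηw) words of each weight 1 ≤ w ≤ N exp(-δm), and none with w < 2^(m/4)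
(`eventually_weightCount_le`). With 2^η z < 1 their contribution is the tail of a geometric series
(`eventually_weightEnum_sub_one_le`). -/

set_option linter.unusedSectionVars false

/-! ### Expectation on the biased cube and Russo's formula. -/

section BiasedCube

variable {ι : Type*} [Fintype ι] [DecidableEq ι]

/-- The weight of a set in which every element is present independently with probability `e`. -/
noncomputable def biasedWeight (e : ℝ) (S : Finset ι) : ℝ := ∏ i, if i ∈ S then e else 1 - e

/-- Expectation over a random subset containing each element with probability `e`. -/
noncomputable def biasedExp (e : ℝ) (f : Finset ι → ℝ) : ℝ := ∑ S, biasedWeight e S * f S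

/-- The discrete derivative in direction `i`. -/
def discreteDeriv (i : ι) (f : Finset ι → ℝ) (S : Finset ι) : ℝ := f (insert i S) - f (S.erase i)

theorem sum_finset_eq_sum_erase (i : ι) (g : Finset ι → ℝ) :
    ∑ S, g S = ∑ T ∈ (Finset.univ.erase i).powerset, (g T + g (insert i T)) := by
  rw [← Finset.powerset_univ, ← Finset.insert_erase (Finset.mem_univ i),
    Finset.sum_powerset_insert (Finset.notMem_erase i _), Finset.sum_add_distrib,
    Finset.erase_insert (Finset.notMem_erase i _)]

theorem biasedWeight_of_notMem (e : ℝ) {i : ι} {T : Finset ι} (h : i ∉ T) :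
    biasedWeight e T = (1 - e) * ∏ j ∈ Finset.univ.erase i, if j ∈ T then e else 1 - e := by
  rw [biasedWeight, ← Finset.mul_prod_erase _ _ (Finset.mem_univ i), if_neg h]

theorem biasedWeight_insert (e : ℝ) (i : ι) (T : Finset ι) :
    biasedWeight e (insert i T) = e * ∏ j ∈ Finset.univ.erase i, if j ∈ T then e else 1 - e := by
  rw [biasedWeight, ← Finset.mul_prod_erase _ _ (Finset.mem_univ i),
    if_pos (Finset.mem_insert_self _ _)]
  congr 1
  refine Finset.prod_congr rfl fun j hj => ?_
  simp [Finset.mem_insert, Finset.ne_of_mem_erase hj]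

/-- Resampling coordinate `i` leaves the expectation unchanged. This reduces inequalities on the
cube to two-point inequalities, one coordinate at a time. -/
theorem biasedExp_average (e : ℝ) (i : ι) (f : Finset ι → ℝ) :
    biasedExp e f = biasedExp e (fun S => e * f (insert i S) + (1 - e) * f (S.erase i)) := by
  rw [biasedExp, biasedExp, sum_finset_eq_sum_erase i, sum_finset_eq_sum_erase i]
  refine Finset.sum_congr rfl fun T hT => ?_
  have hi : i ∉ T := fun h => Finset.notMem_erase i _ (Finset.mem_powerset.1 hT h)
  rw [biasedWeight_of_notMem e hi, biasedWeight_insert, Finset.insert_idem,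
    Finset.erase_insert hi, Finset.erase_eq_of_notMem hi]
  ring

theorem biasedWeight_nonneg {e : ℝ} (h0 : 0 ≤ e) (h1 : e ≤ 1) (S : Finset ι) :
    0 ≤ biasedWeight e S :=
  Finset.prod_nonneg fun i _ => by split_ifs <;> linarith

theorem sum_biasedWeight (e : ℝ) : ∑ S : Finset ι, biasedWeight e S = 1 := by
  have h := Finset.prod_add (fun _ : ι => e) (fun _ => 1 - e) Finset.univ
  simp only [add_sub_cancel, Finset.prod_const_one, Finset.powerset_univ] at h
  rw [h]
  refine Finset.sum_congr rfl fun S _ => ?_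
  rw [biasedWeight, ← Finset.prod_mul_prod_compl S, Finset.compl_eq_univ_sdiff]
  congr 1
  · exact Finset.prod_congr rfl fun i hi => if_pos hi
  · exact Finset.prod_congr rfl fun i hi => if_neg (Finset.mem_sdiff.1 hi).2

theorem biasedExp_const (e c : ℝ) : biasedExp (ι := ι) e (fun _ => c) = c := by
  rw [biasedExp, ← Finset.sum_mul, sum_biasedWeight, one_mul]

theorem biasedExp_add (e : ℝ) (f g : Finset ι → ℝ) :
    biasedExp e (fun S => f S + g S) = biasedExp e f + biasedExp e g := by
  simp [biasedExp, mul_add, Finset.sum_add_distrib]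

theorem biasedExp_sub (e : ℝ) (f g : Finset ι → ℝ) :
    biasedExp e (fun S => f S - g S) = biasedExp e f - biasedExp e g := by
  simp [biasedExp, mul_sub, Finset.sum_sub_distrib]

theorem biasedExp_const_mul (e c : ℝ) (f : Finset ι → ℝ) :
    biasedExp e (fun S => c * f S) = c * biasedExp e f := by
  simp [biasedExp, Finset.mul_sum, mul_left_comm]

theorem biasedExp_sum {κ : Type*} (s : Finset κ) (e : ℝ) (f : κ → Finset ι → ℝ) :
    biasedExp e (fun S => ∑ k ∈ s, f k S) = ∑ k ∈ s, biasedExp e (f k) := by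
  simp only [biasedExp, Finset.mul_sum]
  exact Finset.sum_comm

theorem biasedExp_mono {e : ℝ} (h0 : 0 ≤ e) (h1 : e ≤ 1) {f g : Finset ι → ℝ}
    (h : ∀ S, f S ≤ g S) : biasedExp e f ≤ biasedExp e g :=
  Finset.sum_le_sum fun S _ => mul_le_mul_of_nonneg_left (h S) (biasedWeight_nonneg h0 h1 S)

theorem biasedExp_nonneg {e : ℝ} (h0 : 0 ≤ e) (h1 : e ≤ 1) {f : Finset ι → ℝ}
    (h : ∀ S, 0 ≤ f S) : 0 ≤ biasedExp e f :=
  Finset.sum_nonneg fun S _ => mul_nonneg (biasedWeight_nonneg h0 h1 S) (h S)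

theorem biasedExp_mul_sq_le {e : ℝ} (h0 : 0 ≤ e) (h1 : e ≤ 1) (f g : Finset ι → ℝ) :
    biasedExp e (fun S => f S * g S) ^ 2 ≤
      biasedExp e (fun S => f S ^ 2) * biasedExp e (fun S => g S ^ 2) := by
  have h := Finset.sum_mul_sq_le_sq_mul_sq Finset.univ
    (fun S => √(biasedWeight e S) * f S) (fun S => √(biasedWeight e S) * g S)
  have hs : ∀ S : Finset ι, √(biasedWeight e S) * √(biasedWeight e S) = biasedWeight e S :=
    fun S => Real.mul_self_sqrt (biasedWeight_nonneg h0 h1 S)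
  refine le_of_eq_of_le (congrArg (· ^ 2) (Finset.sum_congr rfl fun S _ => ?_))
    (h.trans_eq (congrArg₂ (· * ·) (Finset.sum_congr rfl fun S _ => ?_)
      (Finset.sum_congr rfl fun S _ => ?_)))
  · linear_combination (-(f S * g S)) * hs S
  · linear_combination (f S ^ 2) * hs S
  · linear_combination (g S ^ 2) * hs S

theorem biasedExp_map_equiv (e : ℝ) (π : Equiv.Perm ι) (f : Finset ι → ℝ) :
    biasedExp e (fun S => f (S.map π.toEmbedding)) = biasedExp e f := by
  rw [biasedExp, biasedExp]
  refine Fintype.sum_equiv (Equiv.finsetCongr π) _ _ fun S => ?_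
  rw [Equiv.finsetCongr_apply]
  congr 1
  rw [biasedWeight, biasedWeight]
  refine Fintype.prod_equiv π _ _ fun i => ?_
  simp

/-- Russo's formula. -/
theorem hasDerivAt_biasedExp (f : Finset ι → ℝ) (e : ℝ) :
    HasDerivAt (fun t => biasedExp t f) (∑ i, biasedExp e (discreteDeriv i f)) e := by
  have h1 : ∀ S : Finset ι, HasDerivAt (fun t => biasedWeight t S * f S)
      ((∑ i, (∏ j ∈ Finset.univ.erase i, if j ∈ S then e else 1 - e) *
        (if i ∈ S then 1 else -1)) * f S) e := by
    intro S
    refine HasDerivAt.mul_const ?_ _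
    have := HasDerivAt.fun_finsetProd (u := Finset.univ)
      (f := fun (i : ι) (t : ℝ) => if i ∈ S then t else 1 - t)
      (f' := fun i => if i ∈ S then 1 else -1) (x := e) (fun i _ => by
        by_cases h : i ∈ S
        · simpa [h] using hasDerivAt_id' e
        · simpa [h] using (hasDerivAt_id' e).const_sub 1)
    simpa [biasedWeight] using this
  have h2 := HasDerivAt.fun_sum (u := Finset.univ) fun (S : Finset ι) _ => h1 S
  refine h2.congr_deriv ?_
  simp only [Finset.sum_mul]
  rw [Finset.sum_comm]
  refine Finset.sum_congr rfl fun i _ => ?_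
  rw [biasedExp, sum_finset_eq_sum_erase i, sum_finset_eq_sum_erase i]
  refine Finset.sum_congr rfl fun T hT => ?_
  have hi : i ∉ T := fun h => Finset.notMem_erase i _ (Finset.mem_powerset.1 hT h)
  have hp : (∏ j ∈ Finset.univ.erase i, if j ∈ insert i T then e else 1 - e) =
      ∏ j ∈ Finset.univ.erase i, if j ∈ T then e else 1 - e :=
    Finset.prod_congr rfl fun j hj => by simp [Finset.mem_insert, Finset.ne_of_mem_erase hj]
  rw [biasedWeight_of_notMem e hi, biasedWeight_insert, hp, discreteDeriv, discreteDeriv,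
    Finset.insert_idem, Finset.erase_insert hi, Finset.erase_eq_of_notMem hi, if_neg hi,
    if_pos (Finset.mem_insert_self _ _)]
  ring

end BiasedCube

/-! ### Biased Fourier analysis, hypercontractivity and the Kahn–Kalai–Linial inequality. -/

section BiasedFourier

variable {ι : Type*} [Fintype ι] [DecidableEq ι]

/-- The normalized, centred `i`-th coordinate of the `e`-biased cube. -/
noncomputable def biasedChar (e : ℝ) (i : ι) (S : Finset ι) : ℝ :=
  if i ∈ S then √((1 - e) / e) else -√(e / (1 - e))

/-- The orthonormal basis of functions on the `e`-biased cube. -/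
noncomputable def fourierChar (e : ℝ) (T S : Finset ι) : ℝ := ∏ i ∈ T, biasedChar e i S

/-- The Fourier coefficients of a function on the `e`-biased cube. -/
noncomputable def fourierCoef (e : ℝ) (f : Finset ι → ℝ) (T : Finset ι) : ℝ :=
  biasedExp e (fun S => f S * fourierChar e T S)

/-- The `i`-th Laplacian on the `e`-biased cube. -/
def laplacian (e : ℝ) (i : ι) (f : Finset ι → ℝ) (S : Finset ι) : ℝ :=
  f S - (e * f (insert i S) + (1 - e) * f (S.erase i))

section Constants

variable {e : ℝ} (h0 : 0 < e) (h1 : e < 1)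
include h0 h1

theorem mul_sq_sqrt_odds : e * √((1 - e) / e) ^ 2 = 1 - e := by
  rw [Real.sq_sqrt (div_nonneg (by linarith) h0.le)]
  field_simp

theorem mul_sq_sqrt_odds_inv : (1 - e) * √(e / (1 - e)) ^ 2 = e := by
  have : 1 - e ≠ 0 := by linarith
  rw [Real.sq_sqrt (div_nonneg h0.le (by linarith))]
  field_simp

theorem sqrt_odds_mul : √((1 - e) / e) * √(e / (1 - e)) = 1 := by
  have : 1 - e ≠ 0 := by linarith
  rw [← Real.sqrt_mul (div_nonneg (by linarith) h0.le)]
  rw [show (1 - e) / e * (e / (1 - e)) = 1 by field_simp, Real.sqrt_one]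

theorem mul_sqrt_odds : e * √((1 - e) / e) = (1 - e) * √(e / (1 - e)) := by
  linear_combination (-(e * √((1 - e) / e))) * sqrt_odds_mul h0 h1 +
    √(e / (1 - e)) * mul_sq_sqrt_odds h0 h1

end Constants

theorem biasedChar_insert_self (e : ℝ) (i : ι) (S : Finset ι) :
    biasedChar e i (insert i S) = √((1 - e) / e) := if_pos (Finset.mem_insert_self _ _)

theorem biasedChar_erase_self (e : ℝ) (i : ι) (S : Finset ι) :
    biasedChar e i (S.erase i) = -√(e / (1 - e)) := if_neg (Finset.notMem_erase _ _)

theorem fourierChar_insert_of_notMem (e : ℝ) {i : ι} {T : Finset ι} (h : i ∉ T) (S : Finset ι) :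
    fourierChar e T (insert i S) = fourierChar e T S :=
  Finset.prod_congr rfl fun j hj => by
    simp [biasedChar, Finset.mem_insert, ne_of_mem_of_not_mem hj h]

theorem fourierChar_erase_of_notMem (e : ℝ) {i : ι} {T : Finset ι} (h : i ∉ T) (S : Finset ι) :
    fourierChar e T (S.erase i) = fourierChar e T S :=
  Finset.prod_congr rfl fun j hj => by
    simp [biasedChar, Finset.mem_erase, ne_of_mem_of_not_mem hj h]

theorem fourierChar_insert (e : ℝ) {i : ι} {T : Finset ι} (h : i ∉ T) (S : Finset ι) :
    fourierChar e (insert i T) S = biasedChar e i S * fourierChar e T S :=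
  Finset.prod_insert h

theorem fourier_expansion {e : ℝ} (h0 : 0 < e) (h1 : e < 1) (f : Finset ι → ℝ) (S : Finset ι) :
    f S = ∑ T, fourierCoef e f T * fourierChar e T S := by
  -- The reproducing kernel factors over the coordinates, and each factor times its weight is 1 or 0
  -- according to whether `S'` and `S` agree there.
  have key : ∀ S' : Finset ι,
      biasedWeight e S' * ∑ T, fourierChar e T S' * fourierChar e T S =
        if S' = S then 1 else 0 := by
    intro S'
    have : ∑ T, fourierChar e T S' * fourierChar e T S =
        ∏ i, (1 + biasedChar e i S' * biasedChar e i S) := by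
      rw [Finset.prod_one_add, Finset.powerset_univ]
      simp only [fourierChar, Finset.prod_mul_distrib]
    rw [this, biasedWeight, ← Finset.prod_mul_distrib]
    have ha := mul_sq_sqrt_odds h0 h1
    have hb := mul_sq_sqrt_odds_inv h0 h1
    have hab := sqrt_odds_mul h0 h1
    have hc : ∀ i, ((if i ∈ S' then e else 1 - e) * (1 + biasedChar e i S' * biasedChar e i S)) =
        if (i ∈ S' ↔ i ∈ S) then 1 else 0 := by
      intro i
      by_cases hs : i ∈ S <;> by_cases hs' : i ∈ S' <;> simp only [biasedChar, hs, hs', if_true,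
        if_false, iff_true, iff_false, not_true]
      · linear_combination ha
      · linear_combination (-(1 - e)) * hab
      · linear_combination (-e) * hab
      · linear_combination hb
    simp_rw [hc]
    rw [Finset.prod_ite_zero]
    simp [Finset.ext_iff]
  simp only [fourierCoef, biasedExp, Finset.sum_mul]
  rw [Finset.sum_comm]
  have : ∀ S' : Finset ι, ∑ T, biasedWeight e S' * (f S' * fourierChar e T S') *
      fourierChar e T S = f S' * if S' = S then 1 else 0 := by
    intro S'
    rw [← key, Finset.mul_sum, Finset.mul_sum]
    exact Finset.sum_congr rfl fun T _ => by ring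
  simp [this]

theorem sum_fourierCoef_sq {e : ℝ} (h0 : 0 < e) (h1 : e < 1) (f : Finset ι → ℝ) :
    ∑ T, fourierCoef e f T ^ 2 = biasedExp e (fun S => f S ^ 2) := by
  have : ∀ S, f S ^ 2 = ∑ T, fourierCoef e f T * (f S * fourierChar e T S) := by
    intro S
    rw [sq]
    nth_rw 2 [fourier_expansion h0 h1 f S]
    rw [Finset.mul_sum]
    exact Finset.sum_congr rfl fun T _ => by ring
  simp_rw [this]
  rw [biasedExp_sum]
  refine Finset.sum_congr rfl fun T _ => ?_
  rw [biasedExp_const_mul, sq, fourierCoef]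

/-- The average over coordinate `i` no longer depends on `i`, and is therefore orthogonal to every
character involving the centred coordinate `i`. -/
theorem fourierCoef_laplacian {e : ℝ} (h0 : 0 < e) (h1 : e < 1) (f : Finset ι → ℝ) {i : ι}
    {T : Finset ι} (hi : i ∈ T) : fourierCoef e (laplacian e i f) T = fourierCoef e f T := by
  have h : biasedExp e (fun S => (e * f (insert i S) + (1 - e) * f (S.erase i)) *
      fourierChar e T S) = 0 := by
    rw [biasedExp_average e i, ← biasedExp_const (ι := ι) e 0]
    congr 1
    funext S
    rw [← Finset.insert_erase hi]
    have hT := Finset.notMem_erase i T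
    rw [fourierChar_insert e hT, fourierChar_insert e hT, biasedChar_insert_self,
      biasedChar_erase_self, fourierChar_insert_of_notMem e hT, fourierChar_erase_of_notMem e hT]
    have hS : insert i (S.erase i) = insert i S := by
      ext j; by_cases hj : j = i <;> simp [hj]
    simp only [Finset.insert_idem, Finset.erase_idem, Finset.erase_insert_eq_erase, hS]
    linear_combination (e * f (insert i S) + (1 - e) * f (S.erase i)) *
      fourierChar e (T.erase i) S * mul_sqrt_odds h0 h1
  rw [fourierCoef, fourierCoef]
  simp_rw [laplacian, sub_mul (f _)]
  rw [biasedExp_sub, h, sub_zero]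

/-- The two-point inequality behind hypercontractivity. -/
theorem two_point_fourth_moment_le {e κ ρ a b : ℝ} (hκ : 0 < κ) (h0 : κ ≤ e) (h1 : κ ≤ 1 - e)
    (hρ : ρ = κ / 2) (ha : e * a ^ 2 = 1 - e) (hb : (1 - e) * b ^ 2 = e)
    (hab : e * a = (1 - e) * b) (q r : ℝ) :
    e * (q + ρ * a * r) ^ 4 + (1 - e) * (q - ρ * b * r) ^ 4 ≤
      q ^ 4 + 2 * (q ^ 2 * r ^ 2) + r ^ 4 := by
  have he0 : 0 < e := by linarith
  have he1 : 0 < 1 - e := by linarith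
  have ha2 : κ * a ^ 2 ≤ 1 := by
    have := mul_le_mul_of_nonneg_right h0 (sq_nonneg a)
    linarith
  have hb2 : κ * b ^ 2 ≤ 1 := by
    have := mul_le_mul_of_nonneg_right h1 (sq_nonneg b)
    linarith
  -- `g` and `G` are the third and fourth moments of the variable equal to `a` with probability `e`
  -- and to `-b` otherwise, which has mean 0 and variance 1. Cauchy–Schwarz gives `g ^ 2 ≤ G`, and
  -- `κ` bounds `G`; the cubic term is then absorbed by AM-GM.
  obtain ⟨g, hgdef⟩ : ∃ g, g = (1 - e) * a - e * b := ⟨_, rfl⟩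
  obtain ⟨G, hGdef⟩ : ∃ G, G = (1 - e) * a ^ 2 + e * b ^ 2 := ⟨_, rfl⟩
  have expand : e * (q + ρ * a * r) ^ 4 + (1 - e) * (q - ρ * b * r) ^ 4 =
      q ^ 4 + 6 * ρ ^ 2 * (q ^ 2 * r ^ 2) + 4 * ρ ^ 3 * g * (q * r ^ 3) + ρ ^ 4 * G * r ^ 4 := by
    rw [hgdef, hGdef]
    linear_combination (4 * q ^ 3 * ρ * r) * hab +
      (6 * q ^ 2 * ρ ^ 2 * r ^ 2 + 4 * q * ρ ^ 3 * r ^ 3 * a + ρ ^ 4 * r ^ 4 * a ^ 2) * ha +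
      (6 * q ^ 2 * ρ ^ 2 * r ^ 2 - 4 * q * ρ ^ 3 * r ^ 3 * b + ρ ^ 4 * r ^ 4 * b ^ 2) * hb
  rw [expand]
  have hg : g ^ 2 ≤ G := by
    have h2 : G - g ^ 2 = e * (1 - e) * (a + b) ^ 2 := by
      rw [hgdef, hGdef]; ring
    have : 0 ≤ e * (1 - e) * (a + b) ^ 2 := by positivity
    linarith
  have hG : κ * G ≤ 1 := by
    have : κ * G = (1 - e) * (κ * a ^ 2) + e * (κ * b ^ 2) := by rw [hGdef]; ring
    rw [this]
    have := mul_le_mul_of_nonneg_left ha2 he1.le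
    have := mul_le_mul_of_nonneg_left hb2 he0.le
    linarith
  have hG0 : 0 ≤ G := (sq_nonneg g).trans hg
  have hcross : 4 * ρ ^ 3 * g * (q * r ^ 3) ≤
      2 * ρ ^ 2 * (q ^ 2 * r ^ 2) + 2 * ρ ^ 4 * g ^ 2 * r ^ 4 := by
    have := sq_nonneg (ρ * (q * r) - ρ ^ 2 * g * r ^ 2)
    linarith
  have hρ2 : ρ ^ 2 ≤ 1 / 16 := by
    have : κ ^ 2 ≤ (1 / 2) ^ 2 := pow_le_pow_left₀ hκ.le (by linarith) 2
    rw [hρ, div_pow]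
    linarith
  have hρ4 : 3 * ρ ^ 4 * G ≤ 1 := by
    have : 3 * ρ ^ 4 * G = κ ^ 3 * (3 / 16 * (κ * G)) := by rw [hρ]; ring
    rw [this]
    exact mul_le_one₀ (pow_le_one₀ hκ.le (by linarith)) (by positivity) (by linarith)
  have e1 : 2 * ρ ^ 4 * g ^ 2 * r ^ 4 ≤ 2 * ρ ^ 4 * G * r ^ 4 := by gcongr
  have e2 := mul_le_mul_of_nonneg_right hρ4 (show 0 ≤ r ^ 4 by positivity)
  have e3 := mul_le_mul_of_nonneg_right hρ2 (show 0 ≤ q ^ 2 * r ^ 2 by positivity)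
  have e4 : 0 ≤ q ^ 2 * r ^ 2 := by positivity
  linarith

/-- Hypercontractivity on the biased cube, from `L²` to `L⁴`. -/
theorem hypercontractive {e κ ρ : ℝ} (hκ : 0 < κ) (h0 : κ ≤ e) (h1 : κ ≤ 1 - e)
    (hρ : ρ = κ / 2) (A : Finset ι) (c : Finset ι → ℝ) :
    biasedExp e (fun S => (∑ T ∈ A.powerset, ρ ^ T.card * c T * fourierChar e T S) ^ 4) ≤
      (∑ T ∈ A.powerset, c T ^ 2) ^ 2 := by
  induction A using Finset.induction_on generalizing c with
  | empty =>
    have : (fun S : Finset ι => (∑ T ∈ (∅ : Finset ι).powerset,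
        ρ ^ T.card * c T * fourierChar e T S) ^ 4) = fun _ => c ∅ ^ 4 := by
      funext S; simp [fourierChar]
    rw [this, biasedExp_const]
    simp [← pow_mul]
  | insert i A hi ih =>
    have he0 : 0 ≤ e := by linarith
    have he1 : e ≤ 1 := by linarith
    set Q : Finset ι → ℝ := fun S => ∑ T ∈ A.powerset, ρ ^ T.card * c T * fourierChar e T S
    set R : Finset ι → ℝ :=
      fun S => ∑ T ∈ A.powerset, ρ ^ T.card * c (insert i T) * fourierChar e T S
    have hT : ∀ T ∈ A.powerset, i ∉ T := fun T hT h => hi (Finset.mem_powerset.1 hT h)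
    have hsplit : ∀ S, ∑ T ∈ (insert i A).powerset, ρ ^ T.card * c T * fourierChar e T S =
        Q S + ρ * biasedChar e i S * R S := by
      intro S
      rw [Finset.sum_powerset_insert hi]
      congr 1
      rw [Finset.mul_sum]
      refine Finset.sum_congr rfl fun T h => ?_
      rw [fourierChar_insert e (hT T h), Finset.card_insert_of_notMem (hT T h)]
      ring
    have hQi : ∀ S, Q (insert i S) = Q S := fun S => Finset.sum_congr rfl fun T h => by
      rw [fourierChar_insert_of_notMem e (hT T h)]
    have hQe : ∀ S, Q (S.erase i) = Q S := fun S => Finset.sum_congr rfl fun T h => by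
      rw [fourierChar_erase_of_notMem e (hT T h)]
    have hRi : ∀ S, R (insert i S) = R S := fun S => Finset.sum_congr rfl fun T h => by
      rw [fourierChar_insert_of_notMem e (hT T h)]
    have hRe : ∀ S, R (S.erase i) = R S := fun S => Finset.sum_congr rfl fun T h => by
      rw [fourierChar_erase_of_notMem e (hT T h)]
    simp_rw [hsplit]
    rw [Finset.sum_powerset_insert hi]
    have hQ := ih c
    have hR := ih (fun T => c (insert i T))
    change biasedExp e (fun S => Q S ^ 4) ≤ _ at hQ
    change biasedExp e (fun S => R S ^ 4) ≤ _ at hR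
    set q := ∑ T ∈ A.powerset, c T ^ 2
    set r := ∑ T ∈ A.powerset, c (insert i T) ^ 2
    have hq : 0 ≤ q := Finset.sum_nonneg fun _ _ => sq_nonneg _
    have hr : 0 ≤ r := Finset.sum_nonneg fun _ _ => sq_nonneg _
    -- Cauchy–Schwarz and the two induction hypotheses bound the mixed term, so the two-point bound
    -- integrates to a perfect square.
    have hQR : biasedExp e (fun S => Q S ^ 2 * R S ^ 2) ≤ q * r := by
      have := biasedExp_mul_sq_le he0 he1 (fun S => Q S ^ 2) (fun S => R S ^ 2)
      simp only [← pow_mul] at this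
      norm_num at this
      refine le_of_sq_le_sq ?_ (mul_nonneg hq hr)
      rw [mul_pow]
      exact this.trans (mul_le_mul hQ hR (biasedExp_nonneg he0 he1 fun S => by positivity)
        (sq_nonneg _))
    calc biasedExp e (fun S => (Q S + ρ * biasedChar e i S * R S) ^ 4)
        ≤ biasedExp e (fun S => Q S ^ 4 + 2 * (Q S ^ 2 * R S ^ 2) + R S ^ 4) := by
          rw [biasedExp_average e i]
          refine biasedExp_mono he0 he1 fun S => ?_
          rw [biasedChar_insert_self, biasedChar_erase_self, hQi, hQe, hRi, hRe]
          refine le_of_eq_of_le ?_ (two_point_fourth_moment_le hκ h0 h1 hρ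
            (mul_sq_sqrt_odds (by linarith) (by linarith))
            (mul_sq_sqrt_odds_inv (by linarith) (by linarith))
            (mul_sqrt_odds (by linarith) (by linarith)) (Q S) (R S))
          ring
      _ ≤ (q + r) ^ 2 := by
          rw [biasedExp_add, biasedExp_add, biasedExp_const_mul]
          nlinarith

theorem abs_laplacian_le {e : ℝ} (h0 : 0 ≤ e) (h1 : e ≤ 1) (i : ι) (f : Finset ι → ℝ)
    (S : Finset ι) : |laplacian e i f S| ≤ |discreteDeriv i f S| := by
  by_cases h : i ∈ S
  · have : laplacian e i f S = (1 - e) * discreteDeriv i f S := by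
      rw [laplacian, discreteDeriv, Finset.insert_eq_of_mem h]; ring
    rw [this, abs_mul, abs_of_nonneg (sub_nonneg.2 h1)]
    exact mul_le_of_le_one_left (abs_nonneg _) (by linarith)
  · have : laplacian e i f S = -(e * discreteDeriv i f S) := by
      rw [laplacian, discreteDeriv, Finset.erase_eq_of_notMem h]; ring
    rw [this, abs_neg, abs_mul, abs_of_nonneg h0]
    exact mul_le_of_le_one_left (abs_nonneg _) h1

/-- The left side is the fourth power of the L² norm of the noisy Laplacian. The Laplacian is
bounded by 1 and vanishes where the derivative does, so it has small L^(4/3) norm; the dual form of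
hypercontractivity turns this into the power 3/2 of the influence. -/
theorem sum_noise_fourierCoef_sq_le {e κ ρ : ℝ} (hκ : 0 < κ) (h0 : κ ≤ e) (h1 : κ ≤ 1 - e)
    (hρ : ρ = κ / 2) (f : Finset ι → ℝ) (i : ι)
    (hD : ∀ S, discreteDeriv i f S = 0 ∨ discreteDeriv i f S = 1) :
    (∑ T with i ∈ T, ρ ^ (2 * T.card) * fourierCoef e f T ^ 2) ^ 2 ≤
      biasedExp e (discreteDeriv i f) ^ 3 := by
  have he0 : 0 < e := by linarith
  have he1 : e < 1 := by linarith
  set J := discreteDeriv i f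
  set P := biasedExp e J
  set Q := ∑ T with i ∈ T, ρ ^ (2 * T.card) * fourierCoef e f T ^ 2
  have hρ0 : 0 < ρ := by rw [hρ]; linarith
  have hQ0 : 0 ≤ Q := Finset.sum_nonneg fun T _ => by positivity
  have hJ2 : ∀ S, J S ^ 2 = J S := fun S => by rcases hD S with h | h <;> simp [h]
  have hJ0 : ∀ S, 0 ≤ J S := fun S => by rcases hD S with h | h <;> simp [h]
  have hP0 : 0 ≤ P := biasedExp_nonneg he0.le he1.le hJ0
  set c : Finset ι → ℝ := fun T => if i ∈ T then ρ ^ T.card * fourierCoef e f T else 0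
  set h : Finset ι → ℝ := fun S => ∑ T, ρ ^ T.card * c T * fourierChar e T S
  have hc : ∑ T, c T ^ 2 = Q := by
    simp only [Q]
    rw [Finset.sum_filter]
    refine Finset.sum_congr rfl fun T _ => ?_
    simp only [c]
    split_ifs
    · ring
    · simp
  have h4 : biasedExp e (fun S => h S ^ 4) ≤ Q ^ 2 := by
    have := hypercontractive hκ h0 h1 hρ Finset.univ c
    rwa [Finset.powerset_univ, hc] at this
  have hQ : Q = biasedExp e (fun S => laplacian e i f S * h S) := by
    have : ∀ S, laplacian e i f S * h S =
        ∑ T, (ρ ^ T.card * c T) * (laplacian e i f S * fourierChar e T S) := by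
      intro S
      rw [Finset.mul_sum]
      exact Finset.sum_congr rfl fun T _ => by ring
    simp_rw [this]
    rw [biasedExp_sum]
    simp only [Q]
    rw [Finset.sum_filter]
    refine Finset.sum_congr rfl fun T _ => ?_
    rw [biasedExp_const_mul]
    simp only [c]
    split_ifs with hi
    · change _ = _ * fourierCoef e (laplacian e i f) T
      rw [fourierCoef_laplacian he0 he1 f hi]; ring
    · simp
  have hL : ∀ S, laplacian e i f S = J S * laplacian e i f S := by
    intro S
    rcases hD S with hh | hh
    · have := abs_laplacian_le he0.le he1.le i f S
      rw [show discreteDeriv i f S = 0 from hh, abs_zero, abs_nonpos_iff] at this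
      rw [this, mul_zero]
    · simp [J, hh]
  have hL1 : ∀ S, laplacian e i f S ^ 2 ≤ J S := by
    intro S
    rw [← hJ2]
    exact sq_le_sq.2 (abs_laplacian_le he0.le he1.le i f S)
  have s1 : Q ^ 2 ≤ P * biasedExp e (fun S => J S * h S ^ 2) := by
    have := biasedExp_mul_sq_le he0.le he1.le J (fun S => laplacian e i f S * h S)
    simp only [hJ2, ← mul_assoc, ← hL] at this
    rw [← hQ] at this
    refine this.trans (mul_le_mul_of_nonneg_left ?_ hP0)
    refine biasedExp_mono he0.le he1.le fun S => ?_
    rw [mul_pow]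
    exact mul_le_mul_of_nonneg_right (hL1 S) (sq_nonneg _)
  have s2 : biasedExp e (fun S => J S * h S ^ 2) ^ 2 ≤ P * Q ^ 2 := by
    have := biasedExp_mul_sq_le he0.le he1.le J (fun S => h S ^ 2)
    simp only [hJ2, ← pow_mul] at this
    exact this.trans (mul_le_mul_of_nonneg_left h4 hP0)
  rcases hQ0.eq_or_lt with hz | hpos
  · rw [← hz]
    simpa using pow_nonneg hP0 3
  · have s3 : (Q ^ 2) ^ 2 ≤ P ^ 3 * Q ^ 2 := by
      calc (Q ^ 2) ^ 2 ≤ (P * biasedExp e (fun S => J S * h S ^ 2)) ^ 2 := by gcongr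
        _ = P ^ 2 * biasedExp e (fun S => J S * h S ^ 2) ^ 2 := by ring
        _ ≤ P ^ 2 * (P * Q ^ 2) := by gcongr
        _ = P ^ 3 * Q ^ 2 := by ring
    rw [sq (Q ^ 2)] at s3
    exact le_of_mul_le_mul_right s3 (by positivity)

/-- A form of the theorem of Kahn, Kalai and Linial on the biased cube: the variance of a monotone
Boolean function is controlled by its influences. -/
theorem variance_le_of_influence_le {e κ ρ P : ℝ} (hκ : 0 < κ) (h0 : κ ≤ e) (h1 : κ ≤ 1 - e)
    (hρ : ρ = κ / 2) (f : Finset ι → ℝ) (hf : ∀ S, f S = 0 ∨ f S = 1)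
    (hD : ∀ i S, discreteDeriv i f S = 0 ∨ discreteDeriv i f S = 1)
    (hP : ∀ i, biasedExp e (discreteDeriv i f) ≤ P) (hP0 : 0 ≤ P) {k : ℕ} (hk : 0 < k) :
    biasedExp e f * (1 - biasedExp e f) ≤
      Fintype.card ι * P / k + (ρ⁻¹) ^ (2 * k) * (Fintype.card ι * (P * √P)) := by
  have he0 : 0 < e := by linarith
  have he1 : e < 1 := by linarith
  have hρ0 : 0 < ρ := by rw [hρ]; linarith
  have hρ1 : ρ ≤ 1 := by linarith
  have hvar : biasedExp e f * (1 - biasedExp e f) = ∑ T with T ≠ ∅, fourierCoef e f T ^ 2 := by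
    have h1 := sum_fourierCoef_sq he0 he1 f
    rw [← Finset.sum_filter_add_sum_filter_not _ (fun T => T ≠ ∅)] at h1
    have h2 : ∑ T : Finset ι with ¬ T ≠ ∅, fourierCoef e f T ^ 2 = biasedExp e f ^ 2 := by
      simp [Finset.filter_eq', fourierCoef, fourierChar]
    have h3 : biasedExp e (fun S => f S ^ 2) = biasedExp e f := by
      congr 1; funext S; rcases hf S with h | h <;> simp [h]
    rw [h2, h3] at h1
    linarith
  have hswap : ∀ g : Finset ι → ℝ, ∑ T : Finset ι, (T.card : ℝ) * g T =
      ∑ i, ∑ T with i ∈ T, g T := by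
    intro g
    simp_rw [Finset.sum_filter]
    rw [Finset.sum_comm]
    refine Finset.sum_congr rfl fun T _ => ?_
    rw [← Finset.sum_filter]
    simp
  have hA : ∑ T : Finset ι, (T.card : ℝ) * fourierCoef e f T ^ 2 ≤ Fintype.card ι * P := by
    rw [hswap, ← nsmul_eq_mul, ← Finset.card_univ]
    refine Finset.sum_le_card_nsmul _ _ _ fun i _ => ?_
    calc ∑ T with i ∈ T, fourierCoef e f T ^ 2
        = ∑ T with i ∈ T, fourierCoef e (laplacian e i f) T ^ 2 :=
          Finset.sum_congr rfl fun T hT => by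
            rw [fourierCoef_laplacian he0 he1 f (Finset.mem_filter.1 hT).2]
      _ ≤ ∑ T, fourierCoef e (laplacian e i f) T ^ 2 :=
          Finset.sum_le_sum_of_subset_of_nonneg (Finset.filter_subset _ _)
            fun _ _ _ => sq_nonneg _
      _ = biasedExp e (fun S => laplacian e i f S ^ 2) := sum_fourierCoef_sq he0 he1 _
      _ ≤ biasedExp e (discreteDeriv i f) := by
          refine biasedExp_mono he0.le he1.le fun S => ?_
          refine (sq_le_sq.2 (abs_laplacian_le he0.le he1.le i f S)).trans_eq ?_
          rcases hD i S with h | h <;> simp [h]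
      _ ≤ P := hP i
  have hB : ∑ T : Finset ι, (T.card : ℝ) * (ρ ^ (2 * T.card) * fourierCoef e f T ^ 2) ≤
      Fintype.card ι * (P * √P) := by
    rw [hswap, ← nsmul_eq_mul, ← Finset.card_univ]
    refine Finset.sum_le_card_nsmul _ _ _ fun i _ => ?_
    refine le_of_sq_le_sq ?_ (by positivity)
    refine (sum_noise_fourierCoef_sq_le hκ h0 h1 hρ f i (hD i)).trans ?_
    rw [mul_pow, Real.sq_sqrt hP0, ← pow_succ]
    refine pow_le_pow_left₀ (biasedExp_nonneg he0.le he1.le fun S => ?_) (hP i) 3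
    rcases hD i S with h | h <;> simp [h]
  rw [hvar]
  calc ∑ T with T ≠ ∅, fourierCoef e f T ^ 2
      ≤ ∑ T with T ≠ ∅, ((T.card : ℝ) * fourierCoef e f T ^ 2 / k +
          (ρ⁻¹) ^ (2 * k) * ((T.card : ℝ) * (ρ ^ (2 * T.card) * fourierCoef e f T ^ 2))) := by
        refine Finset.sum_le_sum fun T hT => ?_
        have hT1 : 1 ≤ T.card :=
          Finset.card_pos.2 (Finset.nonempty_iff_ne_empty.2 (Finset.mem_filter.1 hT).2)
        have hT1' : (1 : ℝ) ≤ T.card := by exact_mod_cast hT1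
        set u := fourierCoef e f T ^ 2
        have hu : 0 ≤ u := sq_nonneg _
        -- Levels from `k` upwards are charged to the total influence divided by `k`, lower levels
        -- to the noisy sum at the price `ρ⁻¹ ^ (2 * k)`.
        rcases le_total k T.card with hkT | hkT
        · have : u ≤ (T.card : ℝ) * u / k := by
            rw [le_div_iff₀ (by exact_mod_cast hk), mul_comm]
            exact mul_le_mul_of_nonneg_right (by exact_mod_cast hkT) hu
          have h2 : 0 ≤ (ρ⁻¹) ^ (2 * k) * ((T.card : ℝ) * (ρ ^ (2 * T.card) * u)) := by positivity
          linarith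
        · have h2 : u ≤ (ρ⁻¹) ^ (2 * k) * ((T.card : ℝ) * (ρ ^ (2 * T.card) * u)) := by
            have h3 : 1 ≤ (ρ⁻¹) ^ (2 * k) * ρ ^ (2 * T.card) := by
              rw [inv_pow, inv_mul_eq_div, one_le_div (by positivity)]
              exact pow_le_pow_of_le_one hρ0.le hρ1 (by omega)
            calc u ≤ 1 * (1 * u) := by simp
              _ ≤ (T.card : ℝ) * (((ρ⁻¹) ^ (2 * k) * ρ ^ (2 * T.card)) * u) := by gcongr
              _ = _ := by ring
          have : 0 ≤ (T.card : ℝ) * u / k := by positivity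
          linarith
    _ ≤ ∑ T : Finset ι, ((T.card : ℝ) * fourierCoef e f T ^ 2 / k +
          (ρ⁻¹) ^ (2 * k) * ((T.card : ℝ) * (ρ ^ (2 * T.card) * fourierCoef e f T ^ 2))) :=
        Finset.sum_le_sum_of_subset_of_nonneg (Finset.filter_subset _ _)
          fun _ _ _ => by positivity
    _ ≤ _ := by
        rw [Finset.sum_add_distrib, ← Finset.sum_div, ← Finset.mul_sum]
        gcongr

end BiasedFourier

/-! ### The multivariate weight enumerator and its comparison with random erasures. -/

section WeightEnumerator

variable {ι : Type*} [Fintype ι] [DecidableEq ι] (C : Submodule (ZMod 2) (ι → ZMod 2))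

open scoped Classical in
/-- The weight enumerator of a binary code, with one variable per coordinate. -/
noncomputable def weightEnum (u : ι → ℝ) : ℝ :=
  ∑ c : C, ∏ i, if (c : ι → ZMod 2) i = 0 then 1 else u i

/-- The nontrivial sign character of `ZMod 2`. -/
def bitSign (a : ZMod 2) : ℝ := if a = 0 then 1 else -1

theorem bitSign_add (a b : ZMod 2) : bitSign (a + b) = bitSign a * bitSign b := by
  have : ∀ a b : ZMod 2, (a + b = 0) = (a = 0 ↔ b = 0) := by decide
  simp only [bitSign, this]
  by_cases ha : a = 0 <;> by_cases hb : b = 0 <;> simp [ha, hb]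

open scoped Classical in
-- A character summed over a group: either it is trivial on the code, or translation by a word of
-- sign -1 shows that the sum vanishes.
theorem sum_prod_bitSign_nonneg (U : Finset ι) :
    0 ≤ ∑ c : C, ∏ i ∈ U, bitSign ((c : ι → ZMod 2) i) := by
  by_cases h : ∀ c : C, ∏ i ∈ U, bitSign ((c : ι → ZMod 2) i) = 1
  · simp [h]
  · push Not at h
    obtain ⟨c₀, h⟩ := h
    have h1 : ∏ i ∈ U, bitSign ((c₀ : ι → ZMod 2) i) = -1 := by
      have : (∏ i ∈ U, bitSign ((c₀ : ι → ZMod 2) i)) ^ 2 = 1 := by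
        rw [← Finset.prod_pow]
        refine Finset.prod_eq_one fun i _ => ?_
        unfold bitSign
        split_ifs <;> norm_num
      exact (sq_eq_one_iff.1 this).resolve_left h
    have h2 : ∑ c : C, ∏ i ∈ U, bitSign ((c : ι → ZMod 2) i) =
        ∑ c : C, ∏ i ∈ U, bitSign (((c + c₀ : C) : ι → ZMod 2) i) :=
      (Fintype.sum_equiv (Equiv.addRight c₀) _ _ fun c => rfl).symm
    simp only [Submodule.coe_add, Pi.add_apply, bitSign_add, Finset.prod_mul_distrib, h1,
      mul_neg_one, Finset.sum_neg_distrib] at h2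
    linarith

/-- This is the positivity behind the MacWilliams identity: each factor is a nonnegative combination
of 1 and the sign character, so the enumerator is a nonnegative combination of character sums. -/
theorem weightEnum_nonneg {v : ι → ℝ} (hv : ∀ i, |v i| ≤ 1) : 0 ≤ weightEnum C v := by
  classical
  have h : ∀ (c : C) (i : ι), (if (c : ι → ZMod 2) i = 0 then 1 else v i) =
      (1 + v i) / 2 + (1 - v i) / 2 * bitSign ((c : ι → ZMod 2) i) := by
    intro c i
    unfold bitSign
    split_ifs <;> ring
  unfold weightEnum
  simp_rw [h, Finset.prod_add, Finset.prod_mul_distrib]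
  rw [Finset.sum_comm]
  refine Finset.sum_nonneg fun T _ => ?_
  simp_rw [← mul_assoc]
  rw [← Finset.mul_sum]
  refine mul_nonneg (mul_nonneg ?_ ?_) (sum_prod_bitSign_nonneg C _)
  · exact Finset.prod_nonneg fun i _ => by linarith [(abs_le.1 (hv i)).1]
  · exact Finset.prod_nonneg fun i _ => by linarith [(abs_le.1 (hv i)).2]

theorem weightEnum_update (u : ι → ℝ) (i : ι) (t : ℝ) :
    weightEnum C (Function.update u i t) =
      (1 - t) * weightEnum C (Function.update u i 0) +
        t * weightEnum C (Function.update u i 1) := by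
  unfold weightEnum
  rw [Finset.mul_sum, Finset.mul_sum, ← Finset.sum_add_distrib]
  refine Finset.sum_congr rfl fun c _ => ?_
  have : ∀ t, ∏ j, (if (c : ι → ZMod 2) j = 0 then (1 : ℝ) else Function.update u i t j) =
      (if (c : ι → ZMod 2) i = 0 then (1 : ℝ) else t) *
        ∏ j ∈ Finset.univ.erase i, if (c : ι → ZMod 2) j = 0 then (1 : ℝ) else u j := by
    intro t
    rw [← Finset.mul_prod_erase _ _ (Finset.mem_univ i), Function.update_self]
    congr 1
    exact Finset.prod_congr rfl fun j hj => by
      rw [Function.update_of_ne (Finset.ne_of_mem_erase hj)]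
  rw [this t, this 0, this 1]
  split_ifs <;> ring

theorem one_le_weightEnum {u : ι → ℝ} (hu : ∀ i, 0 ≤ u i) : 1 ≤ weightEnum C u := by
  classical
  refine le_trans (by simp) (Finset.single_le_sum (s := Finset.univ)
    (f := fun c : C => ∏ i, if (c : ι → ZMod 2) i = 0 then 1 else u i)
    (fun c _ => Finset.prod_nonneg fun i _ => ?_) (Finset.mem_univ 0))
  split_ifs
  exacts [zero_le_one, hu i]

theorem weightEnum_mono {u v : ι → ℝ} (hu : ∀ i, 0 ≤ u i) (h : ∀ i, u i ≤ v i) :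
    weightEnum C u ≤ weightEnum C v := by
  refine Finset.sum_le_sum fun c _ => Finset.prod_le_prod (fun i _ => ?_) fun i _ => ?_
  · split_ifs
    exacts [zero_le_one, hu i]
  · split_ifs
    exacts [le_rfl, h i]

/-- The single-coordinate comparison: a variable with value `z` may be replaced by a random one,
equal to 1 (erased) with probability `e` and to 0 otherwise. -/
theorem logb_weightEnum_update_le {u : ι → ℝ} (hu : ∀ i, 0 ≤ u i) (hu1 : ∀ i, u i ≤ 1) (i : ι)
    {z e : ℝ} (hz0 : 0 ≤ z) (hz1 : z ≤ 1) (he : e = Real.logb 2 (1 + z)) :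
    Real.logb 2 (weightEnum C (Function.update u i z)) ≤
      e * Real.logb 2 (weightEnum C (Function.update u i 1)) +
        (1 - e) * Real.logb 2 (weightEnum C (Function.update u i 0)) := by
  have hupd : ∀ t : ℝ, 0 ≤ t → ∀ j, 0 ≤ Function.update u i t j := fun t ht j => by
    by_cases h : j = i
    · subst h; simpa using ht
    · simpa [h] using hu j
  set G₀ := weightEnum C (Function.update u i 0)
  set G₁ := weightEnum C (Function.update u i 1)
  have hG0 : 1 ≤ G₀ := one_le_weightEnum C (hupd 0 le_rfl)
  have hG01 : G₀ ≤ G₁ := weightEnum_mono C (hupd 0 le_rfl) fun j => by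
    by_cases h : j = i
    · subst h; simp
    · simp [h]
  -- At the value -1 the affine function equals `2 * G₀ - G₁`, which is nonnegative.
  have hG1 : G₁ ≤ 2 * G₀ := by
    have h := weightEnum_update C u i (-1)
    have h2 : 0 ≤ weightEnum C (Function.update u i (-1)) := weightEnum_nonneg C fun j => by
      by_cases h : j = i
      · subst h; simp
      · simpa [h, abs_le] using ⟨by linarith [hu j], hu1 j⟩
    change _ = (1 - -1) * G₀ + -1 * G₁ at h
    linarith
  have h2e : (2 : ℝ) ^ e = 1 + z := by
    rw [he, Real.rpow_logb] <;> linarith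
  have he0 : 0 ≤ e := by
    rw [he]; exact Real.logb_nonneg (by norm_num) (by linarith)
  have he1 : e ≤ 1 := by
    rw [he, Real.logb_le_iff_le_rpow (by norm_num) (by linarith), Real.rpow_one]; linarith
  have hG0p : 0 < G₀ := by linarith
  set t := G₁ / G₀ with ht
  have ht1 : 1 ≤ t := (one_le_div hG0p).2 hG01
  have ht2 : t ≤ 2 := (div_le_iff₀ hG0p).2 hG1
  -- The left side is the chord of the concave function `t ^ e` through t = 1 and t = 2; this fixes
  -- the relation `2 ^ e = 1 + z`.
  have hconc : 1 + z * (t - 1) ≤ t ^ e := by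
    have := (Real.concaveOn_rpow he0 he1).2 (show (1 : ℝ) ∈ Set.Ici 0 by simp)
      (show (2 : ℝ) ∈ Set.Ici 0 by simp) (show 0 ≤ 2 - t by linarith)
      (show 0 ≤ t - 1 by linarith) (by ring)
    simp only [smul_eq_mul, Real.one_rpow, h2e] at this
    rw [show (2 - t) * 1 + (t - 1) * 2 = t by ring] at this
    linarith
  have hG1t : G₁ = G₀ * t := by rw [ht]; field_simp
  have hle : weightEnum C (Function.update u i z) ≤ G₀ * t ^ e := by
    rw [weightEnum_update]
    change (1 - z) * G₀ + z * G₁ ≤ _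
    rw [hG1t]
    have := mul_le_mul_of_nonneg_left hconc hG0p.le
    linarith
  have htp : 0 < t := by linarith
  calc Real.logb 2 (weightEnum C (Function.update u i z))
      ≤ Real.logb 2 (G₀ * t ^ e) :=
        Real.logb_le_logb_of_le (by norm_num)
          (zero_lt_one.trans_le (one_le_weightEnum C (hupd z hz0))) hle
    _ = e * Real.logb 2 G₁ + (1 - e) * Real.logb 2 G₀ := by
        rw [Real.logb_mul hG0p.ne' (Real.rpow_pos_of_pos htp _).ne',
          Real.logb_rpow_eq_mul_logb_of_pos htp, hG1t, Real.logb_mul hG0p.ne' htp.ne']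
        ring

/-- The dimension of the subcode supported on the set `S` of erased coordinates. -/
noncomputable def erasureDim (S : Finset ι) : ℝ :=
  Real.logb 2 (weightEnum C fun i => if i ∈ S then 1 else 0)

/-- The indicator that the coordinate `i` cannot be recovered from the coordinates outside
`insert i S`. -/
noncomputable def erasureFail (i : ι) (S : Finset ι) : ℝ :=
  open scoped Classical in
  if ∃ c ∈ C, c i ≠ 0 ∧ ∀ j, c j ≠ 0 → j = i ∨ j ∈ S then 1 else 0

/-- The weight enumerator is bounded through the average dimension left undetermined by a random
erasure pattern. -/
theorem logb_weightEnum_le_biasedExp {z e : ℝ} (hz0 : 0 ≤ z) (hz1 : z ≤ 1)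
    (he : e = Real.logb 2 (1 + z)) :
    Real.logb 2 (weightEnum C fun _ => z) ≤ biasedExp e (erasureDim C) := by
  have he0 : 0 ≤ e := by
    rw [he]; exact Real.logb_nonneg (by norm_num) (by linarith)
  have he1 : e ≤ 1 := by
    rw [he, Real.logb_le_iff_le_rpow (by norm_num) (by linarith), Real.rpow_one]; linarith
  -- Hybrid between the two sides: coordinates in `A` still carry `z`, the others have already been
  -- randomized.
  let u : Finset ι → Finset ι → ι → ℝ := fun A S i => if i ∈ A then z else if i ∈ S then 1 else 0
  have hu0 : ∀ A S i, 0 ≤ u A S i := fun A S i => by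
    simp only [u]; split_ifs <;> linarith
  have hu1 : ∀ A S i, u A S i ≤ 1 := fun A S i => by
    simp only [u]; split_ifs <;> linarith
  have key : ∀ A : Finset ι, biasedExp e (fun S => Real.logb 2 (weightEnum C (u A S))) ≤
      biasedExp e (erasureDim C) := by
    intro A
    induction A using Finset.induction_on with
    | empty => simp only [u, Finset.notMem_empty, if_false]; rfl
    | insert i A hi ih =>
      refine le_trans ?_ ih
      rw [biasedExp_average e i (fun S => Real.logb 2 (weightEnum C (u A S)))]
      refine biasedExp_mono he0 he1 fun S => ?_
      have e1 : u (insert i A) S = Function.update (u A S) i z := by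
        funext j
        by_cases h : j = i
        · subst h; simp [u]
        · simp [u, h]
      have e2 : u A (insert i S) = Function.update (u A S) i 1 := by
        funext j
        by_cases h : j = i
        · subst h; simp [u, hi]
        · simp [u, h]
      have e3 : u A (S.erase i) = Function.update (u A S) i 0 := by
        funext j
        by_cases h : j = i
        · subst h; simp [u, hi]
        · simp [u, h]
      rw [e1, e2, e3]
      exact logb_weightEnum_update_le C (hu0 A S) (hu1 A S) i hz0 hz1 he
  have := key Finset.univ
  simpa [u, biasedExp_const] using this

/-- Erasing one more coordinate raises the dimension of the supported subcode by one exactly when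
some codeword supported on the erased set involves it. With Russo's formula this links the mean
dimension to the failure probability. -/
theorem discreteDeriv_erasureDim (i : ι) (S : Finset ι) :
    discreteDeriv i (erasureDim C) S = erasureFail C i S := by
  classical
  set u : ι → ℝ := fun j => if j ∈ S then 1 else 0
  have e2 : (fun j => if j ∈ insert i S then (1 : ℝ) else 0) = Function.update u i 1 := by
    funext j
    by_cases h : j = i
    · subst h; simp
    · simp [u, h]
  have e3 : (fun j => if j ∈ S.erase i then (1 : ℝ) else 0) = Function.update u i 0 := by
    funext j
    by_cases h : j = i
    · subst h; simp
    · simp [u, h]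
  have hG0 : 1 ≤ weightEnum C (Function.update u i 0) := one_le_weightEnum C fun j => by
    rw [← e3]; dsimp only; split_ifs <;> norm_num
  rw [discreteDeriv, erasureDim, erasureDim, e2, e3, erasureFail]
  split_ifs with h
  · obtain ⟨c₀, hc₀, h1, h2⟩ := h
    -- Translation by `c₀` flips coordinate `i` and otherwise moves only positions of variable 1, so
    -- it changes the sign of this enumerator. By affinity the value at 1 is then twice the value at
    -- 0.
    have hz : weightEnum C (Function.update u i (-1)) = 0 := by
      have hs : weightEnum C (Function.update u i (-1)) =
          - weightEnum C (Function.update u i (-1)) := by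
        conv_lhs => unfold weightEnum
        rw [← Fintype.sum_equiv (Equiv.addRight (⟨c₀, hc₀⟩ : C)) _ _ fun c => rfl, weightEnum,
          ← Finset.sum_neg_distrib]
        refine Finset.sum_congr rfl fun c _ => ?_
        have hone : ∀ a b : ZMod 2, b ≠ 0 → (a + b = 0 ↔ a ≠ 0) := by decide
        have hp : (-1 : ℝ) = ∏ j, if j = i then -1 else 1 := by simp
        refine Eq.trans ?_ (neg_one_mul _)
        conv_rhs => rw [hp]
        rw [← Finset.prod_mul_distrib]
        refine Finset.prod_congr rfl fun j _ => ?_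
        simp only [Equiv.coe_addRight, Submodule.coe_add, Pi.add_apply]
        by_cases hj : j = i
        · subst hj
          simp only [hone _ _ h1, Function.update_self]
          by_cases hcj : (c : ι → ZMod 2) j = 0 <;> simp [hcj]
        · by_cases hj0 : c₀ j = 0
          · simp [hj0, hj]
          · have := (h2 j hj0).resolve_left hj
            simp [hj, u, this]
      linarith
    rw [weightEnum_update] at hz
    have : weightEnum C (Function.update u i 1) = 2 * weightEnum C (Function.update u i 0) := by
      linarith
    rw [this, Real.logb_mul (by norm_num) (by linarith), Real.logb_self_eq_one (by norm_num)]
    ring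
  · have : weightEnum C (Function.update u i 1) = weightEnum C (Function.update u i 0) := by
      refine Finset.sum_congr rfl fun c _ => ?_
      by_cases hi : (c : ι → ZMod 2) i = 0
      · refine Finset.prod_congr rfl fun j _ => ?_
        by_cases hj : j = i
        · subst hj; simp [hi]
        · simp [hj]
      · push Not at h
        obtain ⟨j, hj0, hji, hjS⟩ := h c c.2 hi
        rw [Finset.prod_eq_zero (Finset.mem_univ j), Finset.prod_eq_zero (Finset.mem_univ j)]
        · simp [hj0, hji, u, hjS]
        · simp [hj0, hji, u, hjS]
    rw [this, sub_self]

theorem erasureFail_eq_zero_or_one (i : ι) (S : Finset ι) :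
    erasureFail C i S = 0 ∨ erasureFail C i S = 1 := by
  unfold erasureFail; split_ifs <;> simp

theorem erasureFail_mono (i : ι) {S T : Finset ι} (h : S ⊆ T) :
    erasureFail C i S ≤ erasureFail C i T := by
  classical
  unfold erasureFail
  by_cases hS : ∃ c ∈ C, c i ≠ 0 ∧ ∀ j, c j ≠ 0 → j = i ∨ j ∈ S
  · have hT : ∃ c ∈ C, c i ≠ 0 ∧ ∀ j, c j ≠ 0 → j = i ∨ j ∈ T := by
      obtain ⟨c, hc, h1, h2⟩ := hS
      exact ⟨c, hc, h1, fun j hj => (h2 j hj).imp_right fun hh => h hh⟩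
    rw [if_pos hS, if_pos hT]
  · rw [if_neg hS]
    split_ifs <;> norm_num

theorem discreteDeriv_erasureFail (i j : ι) (S : Finset ι) :
    discreteDeriv j (erasureFail C i) S = 0 ∨ discreteDeriv j (erasureFail C i) S = 1 := by
  have h := erasureFail_mono C i
    ((Finset.erase_subset j S).trans (Finset.subset_insert j S))
  unfold discreteDeriv
  rcases erasureFail_eq_zero_or_one C i (insert j S) with h1 | h1 <;>
    rcases erasureFail_eq_zero_or_one C i (S.erase j) with h2 | h2 <;>
    rw [h1, h2] at h ⊢
  · simp
  · norm_num at h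
  · simp
  · simp

theorem discreteDeriv_erasureFail_self (i : ι) (S : Finset ι) :
    discreteDeriv i (erasureFail C i) S = 0 := by
  classical
  have : ∀ j, (j = i ∨ j ∈ insert i S) ↔ (j = i ∨ j ∈ S.erase i) := fun j => by
    by_cases h : j = i <;> simp [h]
  rw [discreteDeriv, sub_eq_zero, erasureFail, erasureFail]
  exact if_congr (exists_congr fun c => and_congr_right fun _ => and_congr_right fun _ =>
    forall_congr' fun j => imp_congr_right fun _ => this j) rfl rfl

/-- A permutation of the coordinates preserves a code. -/
def IsCodeSymm (π : Equiv.Perm ι) : Prop := ∀ c : ι → ZMod 2, c ∘ π ∈ C ↔ c ∈ C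

variable {C}

theorem IsCodeSymm.erasureFail_map {π : Equiv.Perm ι} (h : IsCodeSymm C π) (i : ι)
    (S : Finset ι) : erasureFail C (π i) (S.map π.toEmbedding) = erasureFail C i S := by
  classical
  unfold erasureFail
  refine if_congr ⟨?_, ?_⟩ rfl rfl
  · rintro ⟨c, hc, h1, h2⟩
    exact ⟨c ∘ π, (h c).2 hc, h1, fun j hj => by simpa using h2 (π j) hj⟩
  · rintro ⟨c, hc, h1, h2⟩
    refine ⟨c ∘ π.symm, (h _).1 ?_, by simpa using h1, fun j hj => ?_⟩
    · rwa [Function.comp_assoc, Equiv.symm_comp_self, Function.comp_id]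
    · have := h2 (π.symm j) hj
      rw [Equiv.symm_apply_eq] at this
      refine this.imp_right fun hh => Finset.mem_map.2 ⟨_, hh, by simp⟩

theorem IsCodeSymm.biasedExp_erasureFail {π : Equiv.Perm ι} (h : IsCodeSymm C π) (e : ℝ) (i : ι) :
    biasedExp e (erasureFail C (π i)) = biasedExp e (erasureFail C i) := by
  rw [← biasedExp_map_equiv e π]
  simp_rw [h.erasureFail_map]

theorem IsCodeSymm.biasedExp_discreteDeriv {π : Equiv.Perm ι} (h : IsCodeSymm C π) (e : ℝ)
    (i j : ι) : biasedExp e (discreteDeriv (π j) (erasureFail C (π i))) =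
      biasedExp e (discreteDeriv j (erasureFail C i)) := by
  rw [← biasedExp_map_equiv e π]
  congr 1
  funext S
  have h1 : insert (π j) (S.map π.toEmbedding) = (insert j S).map π.toEmbedding := by
    simp [Finset.map_insert]
  have h2 : (S.map π.toEmbedding).erase (π j) = (S.erase j).map π.toEmbedding := by
    simp [Finset.map_erase]
  rw [discreteDeriv, h1, h2, h.erasureFail_map, h.erasureFail_map, discreteDeriv]

end WeightEnumerator

/-! ### Maximum likelihood decoding and the Bhattacharyya union bound. -/

section UnionBound

variable {ι : Type*} [Fintype ι] [DecidableEq ι] (C : Submodule (ZMod 2) (ι → ZMod 2))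

theorem bscProb_nonneg {p : ℝ} (hp0 : 0 ≤ p) (hp1 : p ≤ 1) (x y : ι → ZMod 2) :
    0 ≤ bscProb p x y :=
  Finset.prod_nonneg fun i _ => by split_ifs <;> linarith

theorem exists_isMLDecoder (p : ℝ) :
    ∃ D : (ι → ZMod 2) → C, IsMLDecoder p C D := by
  have : ∀ y : ι → ZMod 2, ∃ d : C, ∀ c : C, bscProb p (c : ι → ZMod 2) y ≤ bscProb p d y :=
    fun y => Finite.exists_max _
  choose D hD using this
  exact ⟨D, hD⟩

/-- The sum factors over the coordinates: a position of agreement contributes (1-p) + p = 1, a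
disagreement 2√(p(1-p)). -/
theorem sum_sqrt_bscProb {p : ℝ} (hp0 : 0 ≤ p) (hp1 : p ≤ 1) (x x' : ι → ZMod 2) :
    ∑ y, √(bscProb p x y * bscProb p x' y) =
      ∏ i, if (x' - x) i = 0 then 1 else √(4 * p * (1 - p)) := by
  have h : ∀ y, √(bscProb p x y * bscProb p x' y) =
      ∏ i, √((if y i = x i then 1 - p else p) * (if y i = x' i then 1 - p else p)) := by
    intro y
    rw [bscProb, bscProb, ← Finset.prod_mul_distrib, Real.sqrt_eq_rpow,
      ← Real.finsetProd_rpow]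
    · simp_rw [← Real.sqrt_eq_rpow]
    · intro i _
      exact mul_nonneg (by split_ifs <;> linarith) (by split_ifs <;> linarith)
  simp_rw [h]
  rw [← Fintype.prod_sum (fun i (b : ZMod 2) =>
    √((if b = x i then 1 - p else p) * (if b = x' i then 1 - p else p)))]
  refine Finset.prod_congr rfl fun i _ => ?_
  have hs : √(4 * p * (1 - p)) = 2 * √(p * (1 - p)) := by
    rw [show 4 * p * (1 - p) = 2 ^ 2 * (p * (1 - p)) by ring, Real.sqrt_mul (by norm_num),
      Real.sqrt_sq (by norm_num)]
  have h01 : ∀ a : ZMod 2, a = 0 ∨ a = 1 := by decide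
  have huniv : (Finset.univ : Finset (ZMod 2)) = {0, 1} := rfl
  have hq : 0 ≤ 1 - p := by linarith
  rw [huniv, Finset.sum_pair (by decide), Pi.sub_apply]
  rcases h01 (x i) with h1 | h1 <;> rcases h01 (x' i) with h2 | h2 <;> rw [h1, h2] <;>
    simp [Real.sqrt_mul_self, hp0, hq, hs, mul_comm (1 - p) p] <;> ring

/-- The union bound on the block error probability of maximum likelihood decoding. -/
theorem blockErrorProb_le {p : ℝ} (hp0 : 0 ≤ p) (hp1 : p ≤ 1) {D : (ι → ZMod 2) → C}
    (hD : IsMLDecoder p C D) :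
    blockErrorProb p C D ≤ weightEnum C (fun _ => √(4 * p * (1 - p))) - 1 := by
  classical
  refine ciSup_le fun c => ?_
  set z := √(4 * p * (1 - p))
  have hb : ∀ y : ι → ZMod 2, D y ≠ c → bscProb p (c : ι → ZMod 2) y ≤
      ∑ c' ∈ Finset.univ.erase c, √(bscProb p (c : ι → ZMod 2) y * bscProb p (c' : ι → ZMod 2) y) := by
    intro y hy
    -- The decoded word `D y` is itself a competitor, at least as likely as `c`, so its term alone
    -- already dominates.
    refine le_trans ?_ (Finset.single_le_sum
      (f := fun c' : C => √(bscProb p (c : ι → ZMod 2) y * bscProb p (c' : ι → ZMod 2) y))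
      (fun _ _ => Real.sqrt_nonneg _) (Finset.mem_erase.2 ⟨hy, Finset.mem_univ _⟩))
    refine Real.le_sqrt_of_sq_le ?_
    rw [sq]
    exact mul_le_mul_of_nonneg_left (hD y c) (bscProb_nonneg hp0 hp1 _ _)
  calc decodingErrorProb p C D c
      ≤ ∑ y with D y ≠ c, ∑ c' ∈ Finset.univ.erase c,
          √(bscProb p (c : ι → ZMod 2) y * bscProb p (c' : ι → ZMod 2) y) := by
        unfold decodingErrorProb
        convert Finset.sum_le_sum fun y hy => hb y (Finset.mem_filter.1 hy).2
    _ ≤ ∑ y, ∑ c' ∈ Finset.univ.erase c,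
          √(bscProb p (c : ι → ZMod 2) y * bscProb p (c' : ι → ZMod 2) y) :=
        Finset.sum_le_sum_of_subset_of_nonneg (Finset.filter_subset _ _)
          fun _ _ _ => Finset.sum_nonneg fun _ _ => Real.sqrt_nonneg _
    _ = ∑ c' ∈ Finset.univ.erase c, ∏ i, if ((c' - c : C) : ι → ZMod 2) i = 0 then 1 else z := by
        rw [Finset.sum_comm]
        refine Finset.sum_congr rfl fun c' _ => ?_
        rw [sum_sqrt_bscProb hp0 hp1]
        rfl
    _ = weightEnum C (fun _ => z) - 1 := by
        rw [weightEnum, ← Fintype.sum_equiv (Equiv.subRight c) _ _ fun c' => rfl,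
          ← Finset.add_sum_erase _ _ (Finset.mem_univ c)]
        simp

theorem blockErrorProb_nonneg {p : ℝ} (hp0 : 0 ≤ p) (hp1 : p ≤ 1) (D : (ι → ZMod 2) → C) :
    0 ≤ blockErrorProb p C D :=
  Real.iSup_nonneg fun _ => Finset.sum_nonneg fun _ _ => bscProb_nonneg hp0 hp1 _ _

end UnionBound

/-! ### The area theorem and the sharp threshold for erasures. -/

section SharpThreshold

variable {ι : Type*} [Fintype ι] [DecidableEq ι]

theorem biasedExp_one (f : Finset ι → ℝ) : biasedExp 1 f = f Finset.univ := by
  rw [biasedExp, Finset.sum_eq_single Finset.univ]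
  · simp [biasedWeight]
  · intro S _ hS
    obtain ⟨i, hi⟩ : ∃ i, i ∉ S := by
      by_contra! h
      exact hS (Finset.eq_univ_iff_forall.2 h)
    rw [biasedWeight_of_notMem 1 hi]
    simp
  · simp

theorem biasedExp_zero (f : Finset ι → ℝ) : biasedExp 0 f = f ∅ := by
  rw [biasedExp, Finset.sum_eq_single ∅]
  · simp [biasedWeight]
  · intro S _ hS
    obtain ⟨i, hi⟩ := Finset.nonempty_iff_ne_empty.2 hS
    rw [← Finset.insert_eq_of_mem hi, biasedWeight_insert]
    simp
  · simp

variable (C : Submodule (ZMod 2) (ι → ZMod 2))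

theorem erasureDim_univ : erasureDim C Finset.univ = Module.finrank (ZMod 2) C := by
  classical
  have h : weightEnum C (fun i => if i ∈ (Finset.univ : Finset ι) then 1 else 0) =
      (2 : ℝ) ^ Module.finrank (ZMod 2) C := by
    simp only [weightEnum, Finset.mem_univ, if_true, ite_self, Finset.prod_const_one,
      Finset.sum_const, Finset.card_univ, nsmul_eq_mul, mul_one]
    rw [Module.card_eq_pow_finrank (K := ZMod 2) (V := C), ZMod.card]
    norm_num
  rw [erasureDim, h, Real.logb_pow, Real.logb_self_eq_one (by norm_num), mul_one]

theorem erasureDim_empty : erasureDim C ∅ = 0 := by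
  classical
  have h : weightEnum C (fun i => if i ∈ (∅ : Finset ι) then 1 else 0) = 1 := by
    rw [weightEnum, Finset.sum_eq_single 0]
    · simp
    · intro c _ hc
      obtain ⟨i, hi⟩ : ∃ i, (c : ι → ZMod 2) i ≠ 0 := by
        by_contra! h
        exact hc (Subtype.ext (funext h))
      exact Finset.prod_eq_zero (Finset.mem_univ i) (by simp [hi])
    · simp
  rw [erasureDim, h, Real.logb_one]

theorem monotoneOn_biasedExp_erasureFail (x : ι) :
    MonotoneOn (fun t => biasedExp t (erasureFail C x)) (Set.Icc 0 1) := by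
  refine monotoneOn_of_deriv_nonneg (convex_Icc 0 1)
    (fun t _ => (hasDerivAt_biasedExp _ t).continuousAt.continuousWithinAt)
    (fun t _ => (hasDerivAt_biasedExp _ t).differentiableAt.differentiableWithinAt) ?_
  intro t ht
  rw [interior_Icc] at ht
  rw [(hasDerivAt_biasedExp _ t).deriv]
  refine Finset.sum_nonneg fun i _ => biasedExp_nonneg ht.1.le ht.2.le fun S => ?_
  rcases discreteDeriv_erasureFail C x i S with h | h <;> simp [h]

theorem biasedExp_erasureFail_nonneg {t : ℝ} (h0 : 0 ≤ t) (h1 : t ≤ 1) (x : ι) :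
    0 ≤ biasedExp t (erasureFail C x) :=
  biasedExp_nonneg h0 h1 fun S => by
    rcases erasureFail_eq_zero_or_one C x S with h | h <;> simp [h]

variable {C}

theorem hasDerivAt_biasedExp_erasureDim (ht : ∀ i j, ∃ π, π i = j ∧ IsCodeSymm C π) (x : ι)
    (t : ℝ) : HasDerivAt (fun t => biasedExp t (erasureDim C))
      (Fintype.card ι * biasedExp t (erasureFail C x)) t := by
  refine (hasDerivAt_biasedExp (erasureDim C) t).congr_deriv ?_
  rw [← nsmul_eq_mul, ← Finset.card_univ]
  refine Finset.sum_eq_card_nsmul fun i _ => ?_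
  obtain ⟨π, rfl, h⟩ := ht x i
  rw [← h.biasedExp_erasureFail]
  congr 1
  funext S
  exact discreteDeriv_erasureDim C _ S

/-- One half of the area theorem. -/
theorem card_mul_biasedExp_erasureFail_le (ht : ∀ i j, ∃ π, π i = j ∧ IsCodeSymm C π) (x : ι)
    {t : ℝ} (h0 : 0 ≤ t) (h1 : t ≤ 1) :
    Fintype.card ι * biasedExp t (erasureFail C x) * (1 - t) ≤ Module.finrank (ZMod 2) C := by
  have h := (convex_Icc t 1).mul_sub_le_image_sub_of_le_deriv
    (f := fun t => biasedExp t (erasureDim C))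
    (fun s _ => (hasDerivAt_biasedExp _ s).continuousAt.continuousWithinAt)
    (fun s _ => (hasDerivAt_biasedExp _ s).differentiableAt.differentiableWithinAt)
    (C := Fintype.card ι * biasedExp t (erasureFail C x)) (fun s hs => by
      rw [interior_Icc] at hs
      rw [(hasDerivAt_biasedExp_erasureDim ht x s).deriv]
      exact mul_le_mul_of_nonneg_left (monotoneOn_biasedExp_erasureFail C x ⟨h0, h1⟩
        ⟨h0.trans hs.1.le, hs.2.le⟩ hs.1.le) (Nat.cast_nonneg _))
    t ⟨le_rfl, h1⟩ 1 ⟨h1, le_rfl⟩ h1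
  refine h.trans ?_
  simp only [biasedExp_one, erasureDim_univ]
  rw [sub_le_self_iff]
  refine biasedExp_nonneg h0 h1 fun S => Real.logb_nonneg (by norm_num) ?_
  exact one_le_weightEnum C fun i => by split_ifs <;> norm_num

/-- The other half of the area theorem. -/
theorem biasedExp_erasureDim_le (ht : ∀ i j, ∃ π, π i = j ∧ IsCodeSymm C π) (x : ι)
    {t : ℝ} (h0 : 0 ≤ t) (h1 : t ≤ 1) :
    biasedExp t (erasureDim C) ≤ Fintype.card ι * biasedExp t (erasureFail C x) := by
  have h := (convex_Icc 0 t).image_sub_le_mul_sub_of_deriv_le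
    (f := fun t => biasedExp t (erasureDim C))
    (fun s _ => (hasDerivAt_biasedExp _ s).continuousAt.continuousWithinAt)
    (fun s _ => (hasDerivAt_biasedExp _ s).differentiableAt.differentiableWithinAt)
    (C := Fintype.card ι * biasedExp t (erasureFail C x)) (fun s hs => by
      rw [interior_Icc] at hs
      rw [(hasDerivAt_biasedExp_erasureDim ht x s).deriv]
      exact mul_le_mul_of_nonneg_left (monotoneOn_biasedExp_erasureFail C x
        ⟨hs.1.le, hs.2.le.trans h1⟩ ⟨h0, h1⟩ hs.2.le) (Nat.cast_nonneg _))
    0 ⟨le_rfl, h0⟩ t ⟨h0, le_rfl⟩ h0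
  simp only [biasedExp_zero, erasureDim_empty, sub_zero] at h
  refine h.trans (mul_le_of_le_one_right ?_ h1)
  exact mul_nonneg (Nat.cast_nonneg _) (biasedExp_erasureFail_nonneg C h0 h1 x)

/-- If the total influence were below kV/2, the second term would have to exceed V/2. That forces P
> 1/(qk)², hence NP > N/(qk)² ≥ k, a contradiction. -/
theorem mul_le_of_kahn_kalai_linial {N V P q : ℝ} {k : ℕ} (hk : 0 < k) (hN : 0 < N) (hV0 : 0 ≤ V)
    (hV1 : V ≤ 1) (hP : 0 ≤ P) (hq : 0 < q) (h : V ≤ N * P / k + q * (N * (P * √P)))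
    (hbig : q ^ 2 * k ^ 3 ≤ N) : k * V / 2 ≤ N * P := by
  by_contra! hlt
  have hk' : (0 : ℝ) < k := by exact_mod_cast hk
  have hV : 0 < V := by
    rcases hV0.eq_or_lt with h0 | h0
    · rw [← h0] at hlt
      have := mul_nonneg hN.le hP
      simp at hlt
      linarith
    · exact h0
  have h1 : N * P / k < V / 2 := by
    rw [div_lt_iff₀ hk']; linarith
  have h2 : V / 2 < q * (N * P * √P) := by
    have : q * (N * (P * √P)) = q * (N * P * √P) := by ring
    linarith
  have h3 : q * (N * P * √P) ≤ q * (k * V / 2 * √P) := by gcongr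
  have h4 : 1 < q * k * √P := by
    have : V / 2 * 1 < V / 2 * (q * k * √P) := by linarith
    exact lt_of_mul_lt_mul_left this (by positivity)
  have h5 : 1 < q ^ 2 * k ^ 2 * P := by
    have : 1 ^ 2 < (q * k * √P) ^ 2 := pow_lt_pow_left₀ h4 (by norm_num) (by norm_num)
    rw [mul_pow, mul_pow, Real.sq_sqrt hP] at this
    linarith
  have h6 : N < q ^ 2 * k ^ 2 * (N * P) := by
    have := mul_lt_mul_of_pos_left h5 hN
    linarith
  have h7 : q ^ 2 * k ^ 2 * (N * P) ≤ q ^ 2 * k ^ 2 * (k * V / 2) := by gcongr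
  have h8 : q ^ 2 * k ^ 2 * (k * V / 2) = q ^ 2 * k ^ 3 * V / 2 := by ring
  have h9 : q ^ 2 * k ^ 3 * V ≤ N * 1 := by gcongr
  linarith

/-- A doubly transitive code of rate below `1 - e₂` recovers every coordinate of a random erasure
pattern of density `e₁ < e₂` with high probability. -/
theorem biasedExp_erasureFail_le {e₁ e₂ η κ : ℝ} (hκ : 0 < κ) (h1 : κ ≤ e₁) (h12 : e₁ ≤ e₂)
    (h2 : κ ≤ 1 - e₂) (ht : ∀ i j, ∃ π, π i = j ∧ IsCodeSymm C π)
    (ht2 : ∀ x i j, i ≠ x → j ≠ x → ∃ π, π x = x ∧ π i = j ∧ IsCodeSymm C π)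
    (hrate : codeRate C ≤ (1 - η) * (1 - e₂)) (x : ι) (hcard : 2 ≤ Fintype.card ι) {k : ℕ}
    (hk : 0 < k) (hbig : ((κ / 2)⁻¹ ^ (2 * k)) ^ 2 * (k : ℝ) ^ 3 ≤ Fintype.card ι) :
    biasedExp e₁ (erasureFail C x) ≤ Real.exp (-(k * η / 4 * (e₂ - e₁))) := by
  have hN : (0 : ℝ) < Fintype.card ι := by
    have : 0 < Fintype.card ι := by omega
    exact_mod_cast this
  have hcard' : (2 : ℝ) ≤ Fintype.card ι := by exact_mod_cast hcard
  set N : ℝ := ((Fintype.card ι : ℕ) : ℝ) with hNdef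
  set h : ℝ → ℝ := fun t => biasedExp t (erasureFail C x) with hh
  have hnn : ∀ t, e₁ ≤ t → t ≤ e₂ → 0 ≤ h t := fun t h3 h4 =>
    biasedExp_erasureFail_nonneg C (by linarith) (by linarith) x
  -- The area theorem keeps the failure probability away from 1, so the factor `1 - h t` of the
  -- variance is at least `η` on the whole interval.
  have hη : h e₂ ≤ 1 - η := by
    have ha := card_mul_biasedExp_erasureFail_le ht x (t := e₂) (by linarith) (by linarith)
    have hr : (Module.finrank (ZMod 2) C : ℝ) ≤ N * ((1 - η) * (1 - e₂)) := by
      rw [codeRate, div_le_iff₀ hN] at hrate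
      linarith
    have : N * (1 - e₂) * h e₂ ≤ N * (1 - e₂) * (1 - η) := by linarith
    exact le_of_mul_le_mul_left this (mul_pos hN (by linarith))
  have hle : ∀ t, e₁ ≤ t → t ≤ e₂ → h t ≤ 1 - η := fun t h3 h4 =>
    (monotoneOn_biasedExp_erasureFail C x ⟨by linarith, by linarith⟩
      ⟨by linarith, by linarith⟩ h4).trans hη
  have hle1 : ∀ t, e₁ ≤ t → t ≤ e₂ → h t ≤ 1 := fun t h3 h4 => by
    refine (biasedExp_mono (by linarith) (by linarith) (g := fun _ => 1) fun S => ?_).trans_eq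
      (biasedExp_const _ _)
    rcases erasureFail_eq_zero_or_one C x S with h | h <;> simp [h]
  set K := k * η / 4
  have hderiv : ∀ t, e₁ ≤ t → t ≤ e₂ →
      K * h t ≤ ∑ i, biasedExp t (discreteDeriv i (erasureFail C x)) := by
    intro t h3 h4
    have : Nontrivial ι := Fintype.one_lt_card_iff_nontrivial.1 (by omega)
    obtain ⟨i₀, hi₀⟩ := exists_ne x
    set P := biasedExp t (discreteDeriv i₀ (erasureFail C x))
    have hPn : 0 ≤ P := biasedExp_nonneg (by linarith) (by linarith) fun S => by
      rcases discreteDeriv_erasureFail C x i₀ S with h | h <;> simp [h]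
    have hx : biasedExp t (discreteDeriv x (erasureFail C x)) = 0 := by
      rw [← biasedExp_const (ι := ι) t 0]
      congr 1
      funext S
      exact discreteDeriv_erasureFail_self C x S
    -- Double transitivity enters here: the stabilizer of `x` permutes the other coordinates
    -- transitively, so their influences agree.
    have hP : ∀ i, i ≠ x → biasedExp t (discreteDeriv i (erasureFail C x)) = P := by
      intro i hi
      obtain ⟨π, hπx, hπi, hπ⟩ := ht2 x i₀ i hi₀ hi
      have := hπ.biasedExp_discreteDeriv t x i₀
      rwa [hπx, hπi] at this
    have hsum : ∑ i, biasedExp t (discreteDeriv i (erasureFail C x)) = (N - 1) * P := by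
      rw [← Finset.add_sum_erase _ _ (Finset.mem_univ x), hx, zero_add,
        Finset.sum_congr rfl fun i hi => hP i (Finset.ne_of_mem_erase hi), Finset.sum_const,
        Finset.card_erase_of_mem (Finset.mem_univ x), Finset.card_univ, nsmul_eq_mul,
        Nat.cast_sub (by omega)]
      simp [N]
    have hkkl := variance_le_of_influence_le hκ (h1.trans h3) (by linarith) rfl
      (erasureFail C x) (erasureFail_eq_zero_or_one C x) (discreteDeriv_erasureFail C x)
      (P := P) (fun i => by
        by_cases hi : i = x
        · rw [hi, hx]; exact hPn
        · exact (hP i hi).le) hPn hk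
    have hht := hnn t h3 h4
    have hht1 := hle t h3 h4
    have hht2 := hle1 t h3 h4
    have hfin := mul_le_of_kahn_kalai_linial (V := h t * (1 - h t)) hk hN
      (mul_nonneg hht (by linarith)) (mul_le_one₀ hht2 (by linarith) (by linarith)) hPn
      (by positivity) hkkl hbig
    rw [hsum]
    have hkk : (0 : ℝ) ≤ k := Nat.cast_nonneg _
    have h6 : k * (h t * η) / 2 ≤ k * (h t * (1 - h t)) / 2 := by
      have : η ≤ 1 - h t := by linarith
      gcongr
    have h7 : N * P ≤ 2 * ((N - 1) * P) := by
      have := mul_le_mul_of_nonneg_right hcard' hPn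
      linarith
    simp only [K]
    linarith
  -- Grönwall's argument for the differential inequality `hderiv`.
  have hmono : MonotoneOn (fun t => h t * Real.exp (-(K * t))) (Set.Icc e₁ e₂) := by
    have hd : ∀ t, HasDerivAt (fun t => h t * Real.exp (-(K * t)))
        ((∑ i, biasedExp t (discreteDeriv i (erasureFail C x))) * Real.exp (-(K * t)) +
          h t * (Real.exp (-(K * t)) * -(K * 1))) t := fun t =>
      (hasDerivAt_biasedExp _ t).mul (((hasDerivAt_id' t).const_mul K).neg.exp)
    refine monotoneOn_of_deriv_nonneg (convex_Icc e₁ e₂)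
      (fun t _ => (hd t).continuousAt.continuousWithinAt)
      (fun t _ => (hd t).differentiableAt.differentiableWithinAt) ?_
    intro t htm
    rw [interior_Icc] at htm
    rw [(hd t).deriv]
    have := mul_le_mul_of_nonneg_right (hderiv t htm.1.le htm.2.le) (Real.exp_pos (-(K * t))).le
    linarith
  have hfinal := hmono ⟨le_rfl, h12⟩ ⟨h12, le_rfl⟩ h12
  simp only at hfinal
  have h8 : h e₂ * Real.exp (-(K * e₂)) ≤ 1 * Real.exp (-(K * e₂)) :=
    mul_le_mul_of_nonneg_right (hle1 e₂ h12 le_rfl) (Real.exp_pos _).le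
  have h9 : h e₁ * Real.exp (-(K * e₁)) ≤ Real.exp (-(K * (e₂ - e₁))) * Real.exp (-(K * e₁)) := by
    rw [← Real.exp_add]
    refine (hfinal.trans h8).trans_eq ?_
    rw [one_mul]
    congr 1
    ring
  exact le_of_mul_le_mul_right h9 (Real.exp_pos _)

end SharpThreshold

/-! ### Monomial basis, affine symmetries and dimension of Reed–Muller codes. -/

section ReedMuller

variable {m : ℕ}

/-- The evaluation vector of the squarefree monomial with variables in `S`. -/
def monomialFun (S : Finset (Fin m)) (x : Fin m → ZMod 2) : ZMod 2 := ∏ i ∈ S, x i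

theorem eval_mem_span_monomialFun (p : MvPolynomial (Fin m) (ZMod 2)) :
    (fun x => MvPolynomial.eval x p) ∈
      Submodule.span (ZMod 2) (monomialFun '' {S : Finset (Fin m) | S.card ≤ p.totalDegree}) := by
  have h : (fun x => MvPolynomial.eval x p) =
      ∑ d ∈ p.support, p.coeff d • monomialFun d.support := by
    funext x
    rw [MvPolynomial.eval_eq, Finset.sum_apply]
    refine Finset.sum_congr rfl fun d _ => ?_
    rw [Pi.smul_apply, smul_eq_mul, monomialFun]
    congr 1
    refine Finset.prod_congr rfl fun i hi => ?_
    have h01 : ∀ a : ZMod 2, a = 0 ∨ a = 1 := by decide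
    rcases h01 (x i) with h | h <;> rw [h]
    · exact zero_pow (Finsupp.mem_support_iff.1 hi)
    · exact one_pow _
  rw [h]
  refine Submodule.sum_mem _ fun d hd => Submodule.smul_mem _ _ (Submodule.subset_span ⟨_, ?_, rfl⟩)
  refine le_trans ?_ (MvPolynomial.le_totalDegree hd)
  rw [Finset.card_eq_sum_ones]
  exact Finset.sum_le_sum fun i hi => Nat.one_le_iff_ne_zero.2 (Finsupp.mem_support_iff.1 hi)

theorem mem_reedMuller_iff {r : ℕ} {c : (Fin m → ZMod 2) → ZMod 2} :
    c ∈ reedMuller m r ↔ ∃ p : MvPolynomial (Fin m) (ZMod 2), p.totalDegree ≤ r ∧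
      (fun x => MvPolynomial.eval x p) = c := by
  simp only [reedMuller, Submodule.mem_map, MvPolynomial.mem_restrictTotalDegree]
  rfl

theorem reedMuller_eq_span (m r : ℕ) : reedMuller m r =
    Submodule.span (ZMod 2) (monomialFun '' {S : Finset (Fin m) | S.card ≤ r}) := by
  apply le_antisymm
  · intro c hc
    obtain ⟨p, hp, rfl⟩ := mem_reedMuller_iff.1 hc
    exact Submodule.span_mono (Set.image_mono fun S (hS : _ ≤ _) => hS.trans hp)
      (eval_mem_span_monomialFun p)
  · rw [Submodule.span_le]
    rintro _ ⟨S, hS, rfl⟩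
    refine mem_reedMuller_iff.2 ⟨∏ i ∈ S, MvPolynomial.X i, ?_, ?_⟩
    · refine (MvPolynomial.totalDegree_finsetProd _ _).trans ?_
      simpa using hS
    · funext x
      simp [monomialFun]

/-- Substituting affine forms for the variables does not raise the degree; by linearity a squarefree
monomial suffices. -/
theorem reedMuller_comp_affine {r : ℕ} {c : (Fin m → ZMod 2) → ZMod 2} (hc : c ∈ reedMuller m r)
    (A : (Fin m → ZMod 2) →ₗ[ZMod 2] (Fin m → ZMod 2)) (v : Fin m → ZMod 2) :
    (fun x => c (A x + v)) ∈ reedMuller m r := by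
  rw [reedMuller_eq_span] at hc
  induction hc using Submodule.span_induction with
  | mem c hc =>
    obtain ⟨S, hS, rfl⟩ := hc
    let q : Fin m → MvPolynomial (Fin m) (ZMod 2) := fun i =>
      ∑ j, MvPolynomial.C (A (Pi.single j 1) i) * MvPolynomial.X j + MvPolynomial.C (v i)
    refine mem_reedMuller_iff.2 ⟨∏ i ∈ S, q i, ?_, ?_⟩
    · refine (MvPolynomial.totalDegree_finsetProd _ _).trans ?_
      refine le_trans (Finset.sum_le_card_nsmul _ _ 1 fun i _ => ?_) (by simpa using hS)
      refine (MvPolynomial.totalDegree_add _ _).trans (max_le ?_ (by simp))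
      refine MvPolynomial.totalDegree_finsetSum_le fun j _ => ?_
      refine (MvPolynomial.totalDegree_mul _ _).trans ?_
      simp
    · funext x
      simp only [monomialFun, map_prod]
      refine Finset.prod_congr rfl fun i _ => ?_
      simp only [q, map_add, map_sum, map_mul, MvPolynomial.eval_C, MvPolynomial.eval_X,
        Pi.add_apply]
      congr 1
      conv_rhs => rw [LinearMap.pi_apply_eq_sum_univ A x]
      simp only [Finset.sum_apply, Pi.smul_apply, smul_eq_mul]
      refine Finset.sum_congr rfl fun j _ => ?_
      rw [mul_comm, show (fun k => if j = k then (1 : ZMod 2) else 0) = Pi.single j 1 from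
        funext fun k => by simp [Pi.single_apply, eq_comm]]
  | zero => exact Submodule.zero_mem _
  | add a b _ _ ha hb => exact Submodule.add_mem _ ha hb
  | smul t a _ ha => exact Submodule.smul_mem _ t ha

theorem isCodeSymm_of_affine {r : ℕ} (π : Equiv.Perm (Fin m → ZMod 2))
    (A : (Fin m → ZMod 2) ≃ₗ[ZMod 2] (Fin m → ZMod 2)) (v : Fin m → ZMod 2)
    (h : ∀ x, π x = A x + v) : IsCodeSymm (reedMuller m r) π := by
  intro c
  constructor
  · intro hc
    have := reedMuller_comp_affine hc A.symm.toLinearMap (-A.symm v)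
    convert this using 1
    funext x
    simp [h]
  · intro hc
    have := reedMuller_comp_affine hc A.toLinearMap v
    convert this using 1
    funext x
    simp [h]

/-- The transvection x ↦ x + φ(x)(v - u) works for any functional φ equal to 1 at both vectors; a
coordinate or a sum of two coordinates provides φ. -/
theorem exists_linearEquiv_apply_eq {u v : Fin m → ZMod 2} (hu : u ≠ 0) (hv : v ≠ 0) :
    ∃ A : (Fin m → ZMod 2) ≃ₗ[ZMod 2] (Fin m → ZMod 2), A u = v := by
  have h01 : ∀ a : ZMod 2, a ≠ 0 → a = 1 := by decide
  have hφ : ∃ φ : Module.Dual (ZMod 2) (Fin m → ZMod 2), φ u = 1 ∧ φ v = 1 := by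
    obtain ⟨i, hi⟩ := Function.ne_iff.1 hu
    obtain ⟨j, hj⟩ := Function.ne_iff.1 hv
    by_cases h1 : v i = 0
    · by_cases h2 : u j = 0
      · exact ⟨(LinearMap.proj i : Module.Dual (ZMod 2) (Fin m → ZMod 2)) +
          (LinearMap.proj j : Module.Dual (ZMod 2) (Fin m → ZMod 2)), by
          rw [LinearMap.add_apply, LinearMap.proj_apply, LinearMap.proj_apply, h2, h01 _ hi, add_zero], by
          rw [LinearMap.add_apply, LinearMap.proj_apply, LinearMap.proj_apply, h1, h01 _ hj, zero_add]⟩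
      · exact ⟨LinearMap.proj j, h01 _ h2, h01 _ hj⟩
    · exact ⟨LinearMap.proj i, h01 _ hi, h01 _ h1⟩
  obtain ⟨φ, h1, h2⟩ := hφ
  refine ⟨LinearEquiv.transvection (f := φ) (v := v - u) (by rw [map_sub, h1, h2, sub_self]), ?_⟩
  rw [LinearEquiv.transvection.apply, h1, one_smul, add_sub_cancel]

theorem reedMuller_transitive (r : ℕ) (i j : Fin m → ZMod 2) :
    ∃ π, π i = j ∧ IsCodeSymm (reedMuller m r) π :=
  ⟨Equiv.addRight (j - i), by simp,
    isCodeSymm_of_affine _ (LinearEquiv.refl _ _) (j - i) fun x => by simp⟩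

theorem reedMuller_doubly_transitive (r : ℕ) (x i j : Fin m → ZMod 2) (hi : i ≠ x) (hj : j ≠ x) :
    ∃ π, π x = x ∧ π i = j ∧ IsCodeSymm (reedMuller m r) π := by
  obtain ⟨A, hA⟩ := exists_linearEquiv_apply_eq (sub_ne_zero.2 hi) (sub_ne_zero.2 hj)
  refine ⟨A.toEquiv.trans (Equiv.addRight (x - A x)), by simp, ?_,
    isCodeSymm_of_affine _ A (x - A x) fun y => by simp⟩
  rw [map_sub] at hA
  simp only [Equiv.trans_apply, LinearEquiv.coe_toEquiv, Equiv.coe_addRight]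
  rw [add_sub_left_comm, hA, add_sub_cancel]

/-- Squarefree monomials span all functions, so the codimension is at most the number of those of
degree above `r`. -/
theorem two_pow_le_finrank_reedMuller_add (m r : ℕ) :
    2 ^ m ≤ Module.finrank (ZMod 2) (reedMuller m r) +
      (Finset.univ.filter fun S : Finset (Fin m) => r < S.card).card := by
  classical
  set W : Submodule (ZMod 2) ((Fin m → ZMod 2) → ZMod 2) := Submodule.span (ZMod 2)
    ((Finset.univ.filter fun S : Finset (Fin m) => r < S.card).image monomialFun : Set _)
  have htop : reedMuller m r ⊔ W = ⊤ := by
    rw [eq_top_iff, ← MvPolynomial.map_restrict_dom_evalₗ (ZMod 2) (Fin m)]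
    rintro _ ⟨p, _, rfl⟩
    have hp := eval_mem_span_monomialFun p
    change (fun x => MvPolynomial.eval x p) ∈ _
    refine Submodule.span_le.2 ?_ hp
    rintro _ ⟨S, _, rfl⟩
    rcases le_or_gt S.card r with h | h
    · refine Submodule.mem_sup_left ?_
      rw [reedMuller_eq_span]
      exact Submodule.subset_span ⟨S, h, rfl⟩
    · exact Submodule.mem_sup_right (Submodule.subset_span (by
        simp only [Finset.coe_image, Set.mem_image, Finset.coe_filter, Finset.mem_univ, true_and]
        exact ⟨S, h, rfl⟩))
  have h1 := Submodule.finrank_add_le_finrank_add_finrank (reedMuller m r) W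
  rw [htop, finrank_top, Module.finrank_fintype_fun_eq_card] at h1
  have h2 : Module.finrank (ZMod 2) W ≤ _ := finrank_span_finset_le_card _
  have h3 := h2.trans Finset.card_image_le
  simp only [Fintype.card_fun, ZMod.card, Fintype.card_fin] at h1
  omega

theorem card_powerset_filter_mul_pow_le {α : Type*} (A : Finset α) (k : ℕ) {x : ℝ} (h0 : 0 < x)
    (h1 : x ≤ 1) : ((A.powerset.filter fun T => T.card ≤ k).card : ℝ) * x ^ k ≤ (1 + x) ^ A.card := by
  calc ((A.powerset.filter fun T => T.card ≤ k).card : ℝ) * x ^ k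
      = ∑ T ∈ A.powerset.filter fun T => T.card ≤ k, x ^ k := by simp
    _ ≤ ∑ T ∈ A.powerset.filter fun T => T.card ≤ k, x ^ T.card :=
        Finset.sum_le_sum fun T hT => pow_le_pow_of_le_one h0.le h1 (Finset.mem_filter.1 hT).2
    _ ≤ ∑ T ∈ A.powerset, x ^ T.card :=
        Finset.sum_le_sum_of_subset_of_nonneg (Finset.filter_subset _ _) fun _ _ _ => by positivity
    _ = (1 + x) ^ A.card := by
        rw [add_comm, ← Finset.sum_pow_mul_eq_add_pow x 1]
        simp

end ReedMuller

/-! ### Iterated derivatives along random directions. -/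

section LowWeight

variable {m : ℕ}

/-- The iterated derivative of `f` along the images under `A` of the basis vectors in `L`. -/
def iteratedDerivative (L : Finset (Fin m)) (A : (Fin m → ZMod 2) → (Fin m → ZMod 2))
    (f : (Fin m → ZMod 2) → ZMod 2) (x : Fin m → ZMod 2) : ZMod 2 :=
  ∑ I ∈ L.powerset, f (x + A fun i => if i ∈ I then 1 else 0)

/-- The span of the derivatives along the basis vectors in `L` of the codewords of `RM(r, m)`. -/
def derivativeSpan (L : Finset (Fin m)) (r : ℕ) :
    Submodule (ZMod 2) ((Fin m → ZMod 2) → ZMod 2) :=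
  Submodule.span (ZMod 2) ((Finset.univ.filter fun S : Finset (Fin m) => L ⊆ S ∧ S.card ≤ r).image
    fun S => iteratedDerivative L id (monomialFun S) : Finset _)

theorem iteratedDerivative_monomialFun {L S : Finset (Fin m)} (h : ¬ L ⊆ S) :
    iteratedDerivative L id (monomialFun S) = 0 := by
  obtain ⟨i, hiL, hiS⟩ := Finset.not_subset.1 h
  funext x
  rw [iteratedDerivative, ← Finset.insert_erase hiL,
    Finset.sum_powerset_insert (Finset.notMem_erase i L), ← Finset.sum_add_distrib]
  refine Finset.sum_eq_zero fun I _ => ?_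
  have : monomialFun S (x + id fun j => if j ∈ insert i I then 1 else 0) =
      monomialFun S (x + id fun j => if j ∈ I then 1 else 0) :=
    Finset.prod_congr rfl fun j hj => by
      simp [Finset.mem_insert, ne_of_mem_of_not_mem hj hiS]
  rw [this, CharTwo.add_self_eq_zero]

/-- The change of variables `A` turns the chosen directions into basis vectors, and a derivative
along `L` kills every monomial that misses a variable of `L`. So a single space, independent of `A`,
contains all these derivatives. -/
theorem iteratedDerivative_mem {r : ℕ} {f : (Fin m → ZMod 2) → ZMod 2} (L : Finset (Fin m))
    (hf : f ∈ reedMuller m r) (A : (Fin m → ZMod 2) ≃ₗ[ZMod 2] (Fin m → ZMod 2)) :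
    (fun x => iteratedDerivative L A f (A x)) ∈ derivativeSpan L r := by
  have h1 := reedMuller_comp_affine hf A.toLinearMap 0
  simp only [add_zero] at h1
  have h2 : (fun x => iteratedDerivative L A f (A x)) =
      iteratedDerivative L id fun x => f (A.toLinearMap x) := by
    funext x
    simp [iteratedDerivative]
  rw [h2]
  generalize (fun x => f (A.toLinearMap x)) = g at h1
  rw [reedMuller_eq_span] at h1
  induction h1 using Submodule.span_induction with
  | mem c hc =>
    obtain ⟨S, hS, rfl⟩ := hc
    by_cases h : L ⊆ S
    · refine Submodule.subset_span ?_
      rw [Finset.mem_coe]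
      exact Finset.mem_image_of_mem _ (Finset.mem_filter.2 ⟨Finset.mem_univ _, h, hS⟩)
    · rw [iteratedDerivative_monomialFun h]
      exact Submodule.zero_mem _
  | zero =>
    convert Submodule.zero_mem _
    funext x
    simp [iteratedDerivative]
  | add a b _ _ ha hb =>
    convert Submodule.add_mem _ ha hb
    funext x
    simp [iteratedDerivative, Finset.sum_add_distrib]
  | smul t a _ ha =>
    convert Submodule.smul_mem _ t ha
    funext x
    simp [iteratedDerivative, Finset.mul_sum]

theorem card_derivativeSpan_le (L : Finset (Fin m)) (r : ℕ) :
    Nat.card (derivativeSpan L r) ≤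
      2 ^ (Finset.univ.filter fun S : Finset (Fin m) => L ⊆ S ∧ S.card ≤ r).card := by
  rw [Module.natCard_eq_pow_finrank (K := ZMod 2), Nat.card_zmod]
  have h : Module.finrank (ZMod 2) (derivativeSpan L r) ≤ _ := finrank_span_finset_le_card _
  exact Nat.pow_le_pow_right (by norm_num) (h.trans Finset.card_image_le)

/-- For sparse `f` the other points of the cube usually miss the support, and the derivative then
reads off the value of `f` at `x`. -/
theorem iteratedDerivative_eq_self {L : Finset (Fin m)} {A : (Fin m → ZMod 2) → (Fin m → ZMod 2)}
    {f : (Fin m → ZMod 2) → ZMod 2} {x : Fin m → ZMod 2} (hA : A 0 = 0)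
    (h : ∀ I ∈ L.powerset, I ≠ ∅ → f (x + A fun i => if i ∈ I then 1 else 0) = 0) :
    iteratedDerivative L A f x = f x := by
  rw [iteratedDerivative, Finset.sum_eq_single ∅ h]
  · simp only [Finset.notMem_empty, if_false]
    change f (x + A 0) = _
    rw [hA, add_zero]
  · simp

theorem card_linearEquiv_le :
    Nat.card ((Fin m → ZMod 2) ≃ₗ[ZMod 2] (Fin m → ZMod 2)) ≤ 2 ^ (m * m) := by
  have h : Function.Injective fun A : (Fin m → ZMod 2) ≃ₗ[ZMod 2] (Fin m → ZMod 2) =>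
      LinearMap.toMatrix' A.toLinearMap :=
    (LinearEquiv.injective _).comp LinearEquiv.toLinearMap_injective
  refine (Nat.card_le_card_of_injective _ h).trans ?_
  change Nat.card (Fin m → Fin m → ZMod 2) ≤ _
  simp [pow_mul]

instance : Finite ((Fin m → ZMod 2) ≃ₗ[ZMod 2] (Fin m → ZMod 2)) :=
  Finite.of_injective (fun A => (A : (Fin m → ZMod 2) → (Fin m → ZMod 2))) DFunLike.coe_injective

/-- A uniformly random invertible map sends a nonzero vector to a uniformly random nonzero
vector. -/
theorem card_linearEquiv_apply_eq [Fintype ((Fin m → ZMod 2) ≃ₗ[ZMod 2] (Fin m → ZMod 2))]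
    {u w : Fin m → ZMod 2} (hu : u ≠ 0) (hw : w ≠ 0) :
    (2 ^ m - 1) * (Finset.univ.filter fun A : (Fin m → ZMod 2) ≃ₗ[ZMod 2] (Fin m → ZMod 2) =>
      A u = w).card = Fintype.card ((Fin m → ZMod 2) ≃ₗ[ZMod 2] (Fin m → ZMod 2)) := by
  have h1 : ∀ w' ∈ (Finset.univ.erase (0 : Fin m → ZMod 2)),
      (Finset.univ.filter fun A : (Fin m → ZMod 2) ≃ₗ[ZMod 2] (Fin m → ZMod 2) =>
        A u = w').card =
      (Finset.univ.filter fun A : (Fin m → ZMod 2) ≃ₗ[ZMod 2] (Fin m → ZMod 2) =>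
        A u = w).card := by
    intro w' hw'
    obtain ⟨B, hB⟩ := exists_linearEquiv_apply_eq (Finset.ne_of_mem_erase hw') hw
    refine Finset.card_bij (fun A _ => A.trans B) ?_ ?_ ?_
    · intro A hA
      simpa [(Finset.mem_filter.1 hA).2] using hB
    · intro A _ A' _ h
      ext1 x
      have := LinearEquiv.congr_fun h x
      simpa using this
    · intro A hA
      refine ⟨A.trans B.symm, ?_, ?_⟩
      · simp [(Finset.mem_filter.1 hA).2, ← hB]
      · ext1 x
        simp
  have h2 := Finset.card_eq_sum_card_fiberwise (s := Finset.univ)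
    (t := Finset.univ.erase (0 : Fin m → ZMod 2))
    (f := fun A : (Fin m → ZMod 2) ≃ₗ[ZMod 2] (Fin m → ZMod 2) => A u) (fun A _ => by simpa using hu)
  rw [Finset.sum_congr rfl h1, Finset.sum_const, Finset.card_erase_of_mem (Finset.mem_univ _),
    Finset.card_univ, Finset.card_univ, smul_eq_mul] at h2
  rw [h2]
  simp

end LowWeight

/-! ### Counting low weight codewords by majority of derivatives. -/

section LowWeightCount

/-- If every point is bad for few elements of `G`, some tuple of elements of `G` has no point that
is bad for half of its entries. -/
theorem exists_tuple_forall_two_mul_card_lt {G X : Type*} [Fintype G] [DecidableEq G] [Nonempty G]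
    [Fintype X] {t : ℕ} (hX : Fintype.card X < 2 ^ t) (bad : X → Finset G)
    (hbad : ∀ x, 16 * (bad x).card ≤ Fintype.card G) :
    ∃ A : Fin t → G, ∀ x, 2 * (Finset.univ.filter fun j => A j ∈ bad x).card < t := by
  by_contra! h
  set T : X → Finset (Fin t → G) := fun x => Finset.univ.filter fun A =>
    t ≤ 2 * (Finset.univ.filter fun j => A j ∈ bad x).card
  have hG : 0 < Fintype.card G := Fintype.card_pos
  have hT : ∀ x, 2 ^ t * (T x).card ≤ Fintype.card G ^ t := by
    intro x
    -- Exponential Markov inequality: weight 16 per bad entry gives at least `4 ^ t` when half the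
    -- entries are bad, while its mean is at most 2 per entry. A fixed point thus fails with
    -- probability at most 2^(-t), and a union bound over `X` remains.
    have h1 : 4 ^ t * (T x).card ≤ ∑ A : Fin t → G, ∏ j, if A j ∈ bad x then 16 else 1 := by
      calc 4 ^ t * (T x).card = ∑ A ∈ T x, 4 ^ t := by rw [Finset.sum_const, smul_eq_mul, mul_comm]
        _ ≤ ∑ A ∈ T x, ∏ j, if A j ∈ bad x then 16 else 1 := by
          refine Finset.sum_le_sum fun A hA => ?_
          rw [Finset.prod_ite, Finset.prod_const, Finset.prod_const_one, mul_one,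
            show 16 = 4 ^ 2 by norm_num, ← pow_mul]
          exact Nat.pow_le_pow_right (by norm_num) (Finset.mem_filter.1 hA).2
        _ ≤ _ := Finset.sum_le_sum_of_subset (Finset.filter_subset _ _)
    have h2 : ∑ A : Fin t → G, ∏ j, (if A j ∈ bad x then 16 else 1) =
        (∑ g : G, if g ∈ bad x then 16 else 1) ^ t := by
      rw [← Fintype.prod_sum (fun (_ : Fin t) (g : G) => if g ∈ bad x then 16 else 1)]
      simp
    have h3 : (∑ g : G, if g ∈ bad x then 16 else 1) ≤ 2 * Fintype.card G := by
      have : ∀ g : G, (if g ∈ bad x then 16 else 1) = 1 + 15 * if g ∈ bad x then 1 else 0 :=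
        fun g => by split_ifs <;> rfl
      simp_rw [this]
      rw [Finset.sum_add_distrib, ← Finset.mul_sum]
      simp only [Finset.sum_const, Finset.card_univ, smul_eq_mul, mul_one, Finset.sum_ite_mem,
        Finset.univ_inter]
      have := hbad x
      omega
    rw [h2] at h1
    have h4 := h1.trans (Nat.pow_le_pow_left h3 t)
    rw [mul_pow, show 4 = 2 * 2 by norm_num, mul_pow, mul_assoc] at h4
    exact Nat.le_of_mul_le_mul_left h4 (by positivity)
  have hcover : (Finset.univ : Finset (Fin t → G)) ⊆ Finset.univ.biUnion T := by
    intro A _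
    obtain ⟨x, hx⟩ := h A
    exact Finset.mem_biUnion.2 ⟨x, Finset.mem_univ _, Finset.mem_filter.2 ⟨Finset.mem_univ _, hx⟩⟩
  have h5 := (Finset.card_le_card hcover).trans Finset.card_biUnion_le
  rw [Finset.card_univ, Fintype.card_fun, Fintype.card_fin] at h5
  have h6 : 2 ^ t * Fintype.card G ^ t ≤ Fintype.card X * Fintype.card G ^ t := by
    calc 2 ^ t * Fintype.card G ^ t ≤ 2 ^ t * ∑ x, (T x).card := Nat.mul_le_mul_left _ h5
      _ = ∑ x, 2 ^ t * (T x).card := Finset.mul_sum _ _ _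
      _ ≤ ∑ _x : X, Fintype.card G ^ t := Finset.sum_le_sum fun x _ => hT x
      _ = _ := by simp
  have := Nat.le_of_mul_le_mul_right h6 (by positivity)
  omega

variable {m : ℕ}

theorem card_linearEquiv_apply_ne_zero_le
    [Fintype ((Fin m → ZMod 2) ≃ₗ[ZMod 2] (Fin m → ZMod 2))]
    {u : Fin m → ZMod 2} (hu : u ≠ 0) (x : Fin m → ZMod 2) (f : (Fin m → ZMod 2) → ZMod 2) :
    (2 ^ m - 1) * (Finset.univ.filter fun A : (Fin m → ZMod 2) ≃ₗ[ZMod 2] (Fin m → ZMod 2) =>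
      f (x + A u) ≠ 0).card ≤
      hammingNorm f * Fintype.card ((Fin m → ZMod 2) ≃ₗ[ZMod 2] (Fin m → ZMod 2)) := by
  classical
  set s := Finset.univ.filter fun y => f y ≠ 0
  have h1 : (Finset.univ.filter fun A : (Fin m → ZMod 2) ≃ₗ[ZMod 2] (Fin m → ZMod 2) =>
      f (x + A u) ≠ 0) ⊆ s.biUnion fun y => Finset.univ.filter fun A => A u = y - x := by
    intro A hA
    refine Finset.mem_biUnion.2 ⟨x + A u, ?_, ?_⟩
    · exact Finset.mem_filter.2 ⟨Finset.mem_univ _, (Finset.mem_filter.1 hA).2⟩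
    · simp
  have h2 : ∀ y, (2 ^ m - 1) * (Finset.univ.filter
      fun A : (Fin m → ZMod 2) ≃ₗ[ZMod 2] (Fin m → ZMod 2) => A u = y - x).card ≤
      Fintype.card ((Fin m → ZMod 2) ≃ₗ[ZMod 2] (Fin m → ZMod 2)) := by
    intro y
    by_cases hy : y - x = 0
    · rw [Finset.card_eq_zero.2, mul_zero]
      · exact Nat.zero_le _
      · refine Finset.filter_eq_empty_iff.2 fun A _ => ?_
        rw [hy]
        exact fun h => hu (A.map_eq_zero_iff.1 h)
    · exact (card_linearEquiv_apply_eq hu hy).le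
  calc _ ≤ (2 ^ m - 1) * ∑ y ∈ s, (Finset.univ.filter
        fun A : (Fin m → ZMod 2) ≃ₗ[ZMod 2] (Fin m → ZMod 2) => A u = y - x).card :=
        Nat.mul_le_mul_left _ ((Finset.card_le_card h1).trans Finset.card_biUnion_le)
    _ = ∑ y ∈ s, (2 ^ m - 1) * (Finset.univ.filter
        fun A : (Fin m → ZMod 2) ≃ₗ[ZMod 2] (Fin m → ZMod 2) => A u = y - x).card :=
        Finset.mul_sum _ _ _
    _ ≤ ∑ y ∈ s, Fintype.card ((Fin m → ZMod 2) ≃ₗ[ZMod 2] (Fin m → ZMod 2)) :=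
        Finset.sum_le_sum fun y _ => h2 y
    _ = _ := by rw [Finset.sum_const, smul_eq_mul]; rfl

/-- Union bound over fewer than 2^|L| uniformly distributed displacements. The 5 in the exponent
makes the failure probability at most 1/16, one factor 2 being lost in passing from 2^m - 1 to 2^m.
-/
theorem card_bad_le [Fintype ((Fin m → ZMod 2) ≃ₗ[ZMod 2] (Fin m → ZMod 2))] (hm : 1 ≤ m)
    (L : Finset (Fin m)) {f : (Fin m → ZMod 2) → ZMod 2}
    (hf : 2 ^ (L.card + 5) * hammingNorm f ≤ 2 ^ m) (x : Fin m → ZMod 2) :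
    16 * (Finset.univ.filter fun A : (Fin m → ZMod 2) ≃ₗ[ZMod 2] (Fin m → ZMod 2) =>
      ∃ I ∈ L.powerset, I ≠ ∅ ∧ f (x + A fun i => if i ∈ I then 1 else 0) ≠ 0).card ≤
      Fintype.card ((Fin m → ZMod 2) ≃ₗ[ZMod 2] (Fin m → ZMod 2)) := by
  classical
  set g := Fintype.card ((Fin m → ZMod 2) ≃ₗ[ZMod 2] (Fin m → ZMod 2))
  set bad := Finset.univ.filter fun A : (Fin m → ZMod 2) ≃ₗ[ZMod 2] (Fin m → ZMod 2) =>
      ∃ I ∈ L.powerset, I ≠ ∅ ∧ f (x + A fun i => if i ∈ I then 1 else 0) ≠ 0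
  have h1 : bad ⊆ (L.powerset.erase ∅).biUnion fun I => Finset.univ.filter fun A =>
      f (x + A fun i => if i ∈ I then 1 else 0) ≠ 0 := by
    intro A hA
    obtain ⟨I, hI, hI0, hIf⟩ := (Finset.mem_filter.1 hA).2
    exact Finset.mem_biUnion.2 ⟨I, Finset.mem_erase.2 ⟨hI0, hI⟩,
      Finset.mem_filter.2 ⟨Finset.mem_univ _, hIf⟩⟩
  have h2 : (2 ^ m - 1) * bad.card ≤ 2 ^ L.card * (hammingNorm f * g) := by
    calc _ ≤ (2 ^ m - 1) * ∑ I ∈ L.powerset.erase ∅, (Finset.univ.filter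
          fun A : (Fin m → ZMod 2) ≃ₗ[ZMod 2] (Fin m → ZMod 2) =>
            f (x + A fun i => if i ∈ I then 1 else 0) ≠ 0).card :=
          Nat.mul_le_mul_left _ ((Finset.card_le_card h1).trans Finset.card_biUnion_le)
      _ = ∑ I ∈ L.powerset.erase ∅, (2 ^ m - 1) * (Finset.univ.filter
          fun A : (Fin m → ZMod 2) ≃ₗ[ZMod 2] (Fin m → ZMod 2) =>
            f (x + A fun i => if i ∈ I then 1 else 0) ≠ 0).card := Finset.mul_sum _ _ _
      _ ≤ ∑ I ∈ L.powerset.erase ∅, hammingNorm f * g := by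
          refine Finset.sum_le_sum fun I hI => card_linearEquiv_apply_ne_zero_le ?_ x f
          obtain ⟨i, hi⟩ := Finset.nonempty_iff_ne_empty.2 (Finset.ne_of_mem_erase hI)
          intro h0
          simpa [hi] using congrFun h0 i
      _ ≤ 2 ^ L.card * (hammingNorm f * g) := by
          rw [Finset.sum_const, smul_eq_mul, ← Finset.card_powerset]
          exact Nat.mul_le_mul_right _ (Finset.card_le_card (Finset.erase_subset _ _))
  have h3 : 32 * (2 ^ L.card * hammingNorm f) ≤ 2 ^ m := by
    rw [pow_add] at hf
    linarith
  have h4 : 2 ≤ 2 ^ m := by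
    calc 2 = 2 ^ 1 := rfl
      _ ≤ 2 ^ m := Nat.pow_le_pow_right (by norm_num) hm
  have h5 : 2 ^ m ≤ 2 * (2 ^ m - 1) := by omega
  have h6 : (2 ^ m - 1) * (16 * bad.card) * 2 ≤ (2 ^ m - 1) * g * 2 := by
    calc (2 ^ m - 1) * (16 * bad.card) * 2 = 32 * ((2 ^ m - 1) * bad.card) := by ring
      _ ≤ 32 * (2 ^ L.card * (hammingNorm f * g)) := Nat.mul_le_mul_left _ h2
      _ = 32 * (2 ^ L.card * hammingNorm f) * g := by ring
      _ ≤ 2 * (2 ^ m - 1) * g := Nat.mul_le_mul_right _ (h3.trans h5)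
      _ = _ := by ring
  exact Nat.le_of_mul_le_mul_left (Nat.le_of_mul_le_mul_right h6 (by norm_num)) (by omega)

/-- The number of low weight codewords of a Reed–Muller code: each is a pointwise majority of few
iterated derivatives. -/
theorem card_lowWeight_le (hm : 1 ≤ m) (L : Finset (Fin m)) (r : ℕ) :
    Nat.card {f : (Fin m → ZMod 2) → ZMod 2 //
      f ∈ reedMuller m r ∧ 2 ^ (L.card + 5) * hammingNorm f ≤ 2 ^ m} ≤
      (2 ^ (m * m) *
        2 ^ (Finset.univ.filter fun S : Finset (Fin m) => L ⊆ S ∧ S.card ≤ r).card) ^ (m + 1) := by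
  classical
  let G := (Fin m → ZMod 2) ≃ₗ[ZMod 2] (Fin m → ZMod 2)
  let _ : Fintype G := Fintype.ofFinite _
  -- `Ψ` is the majority decoder. Length `m + 1` suffices because there are 2^m < 2^(m+1) points.
  let Ψ : (Fin (m + 1) → G × derivativeSpan L r) → (Fin m → ZMod 2) → ZMod 2 := fun a x =>
    if m + 1 < 2 * (Finset.univ.filter fun j =>
      ((a j).2 : (Fin m → ZMod 2) → ZMod 2) ((a j).1.symm x) = 1).card then 1 else 0
  have hsurj : ∀ f : (Fin m → ZMod 2) → ZMod 2, f ∈ reedMuller m r →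
      2 ^ (L.card + 5) * hammingNorm f ≤ 2 ^ m → ∃ a, Ψ a = f := by
    intro f hf hw
    obtain ⟨A, hA⟩ := exists_tuple_forall_two_mul_card_lt (G := G) (X := Fin m → ZMod 2)
      (t := m + 1) (by simp [pow_succ]) _ (card_bad_le hm L hw)
    refine ⟨fun j => (A j, ⟨_, iteratedDerivative_mem L hf (A j)⟩), ?_⟩
    funext x
    have hx := hA x
    set bad := Finset.univ.filter fun B : G =>
      ∃ I ∈ L.powerset, I ≠ ∅ ∧ f (x + B fun i => if i ∈ I then 1 else 0) ≠ 0
    have hgood : ∀ j, A j ∉ bad → iteratedDerivative L (A j) f x = f x := by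
      intro j hj
      refine iteratedDerivative_eq_self (map_zero _) fun I hI hI0 => ?_
      by_contra hne
      exact hj (Finset.mem_filter.2 ⟨Finset.mem_univ _, I, hI, hI0, hne⟩)
    simp only [Ψ, LinearEquiv.apply_symm_apply]
    have h01 : ∀ a : ZMod 2, a = 0 ∨ a = 1 := by decide
    rcases h01 (f x) with h | h
    · rw [h, if_neg]
      rw [not_lt]
      refine le_trans (Nat.mul_le_mul_left 2 (Finset.card_le_card ?_)) hx.le
      intro j hj
      refine Finset.mem_filter.2 ⟨Finset.mem_univ _, ?_⟩
      by_contra hn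
      have := (Finset.mem_filter.1 hj).2
      rw [hgood j hn, h] at this
      exact zero_ne_one this
    · rw [h, if_pos]
      have h1 : (Finset.univ.filter fun j => A j ∉ bad) ⊆
          Finset.univ.filter fun j => iteratedDerivative L (A j) f x = 1 := by
        intro j hj
        refine Finset.mem_filter.2 ⟨Finset.mem_univ _, ?_⟩
        rw [hgood j (Finset.mem_filter.1 hj).2, h]
      have h2 := Finset.card_le_card h1
      have h3 := Finset.card_filter_add_card_filter_not (s := (Finset.univ : Finset (Fin (m + 1))))
        (fun j => A j ∈ bad)
      rw [Finset.card_univ, Fintype.card_fin] at h3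
      omega
  choose Φ hΦ using hsurj
  have hinj : Function.Injective fun f : {f : (Fin m → ZMod 2) → ZMod 2 //
      f ∈ reedMuller m r ∧ 2 ^ (L.card + 5) * hammingNorm f ≤ 2 ^ m} =>
      Φ f.1 f.2.1 f.2.2 := by
    intro f g h
    apply Subtype.ext
    rw [← hΦ f.1 f.2.1 f.2.2, ← hΦ g.1 g.2.1 g.2.2]
    exact congrArg Ψ h
  refine (Nat.card_le_card_of_injective _ hinj).trans ?_
  rw [Nat.card_fun, Nat.card_prod, Nat.card_fin]
  exact Nat.pow_le_pow_left (Nat.mul_le_mul card_linearEquiv_le (card_derivativeSpan_le L r)) _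

end LowWeightCount

/-! ### Chernoff bounds and the order of a code of given rate. -/

section BinomialTail

theorem one_add_exp_neg_le (σ : ℝ) :
    1 + Real.exp (-σ) ≤ 2 * Real.exp (-(σ / 2) + σ ^ 2 / 8) := by
  have h := Real.cosh_le_exp_half_sq (σ / 2)
  rw [Real.cosh_eq] at h
  have h1 : 1 + Real.exp (-σ) =
      2 * (Real.exp (-(σ / 2)) * ((Real.exp (σ / 2) + Real.exp (-(σ / 2))) / 2)) := by
    have e1 : Real.exp (-(σ / 2)) * Real.exp (σ / 2) = 1 := by
      rw [← Real.exp_add]; simp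
    have e2 : Real.exp (-(σ / 2)) * Real.exp (-(σ / 2)) = Real.exp (-σ) := by
      rw [← Real.exp_add]; congr 1; ring
    linear_combination -e1 - e2
  rw [h1, Real.exp_add]
  have h2 : (σ / 2) ^ 2 / 2 = σ ^ 2 / 8 := by ring
  rw [h2] at h
  have := mul_le_mul_of_nonneg_left h (Real.exp_pos (-(σ / 2))).le
  linarith

/-- A Chernoff bound for the number of small subsets. -/
theorem card_powerset_filter_le_exp {α : Type*} (A : Finset α) (k : ℕ) {σ : ℝ} (hσ : 0 ≤ σ) :
    ((A.powerset.filter fun T => T.card ≤ k).card : ℝ) ≤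
      2 ^ A.card * Real.exp (σ * k - A.card * (σ / 2 - σ ^ 2 / 8)) := by
  have h := card_powerset_filter_mul_pow_le A k (Real.exp_pos (-σ)) (Real.exp_le_one_iff.2 (by linarith))
  have h2 : (1 + Real.exp (-σ)) ^ A.card ≤ (2 * Real.exp (-(σ / 2) + σ ^ 2 / 8)) ^ A.card :=
    pow_le_pow_left₀ (by positivity) (one_add_exp_neg_le σ) _
  have h3 := h.trans h2
  rw [mul_pow, ← Real.exp_nat_mul, ← Real.exp_nat_mul] at h3
  have h4 : Real.exp (k * -σ) * Real.exp (σ * k) = 1 := by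
    rw [← Real.exp_add]; simp [mul_comm]
  calc ((A.powerset.filter fun T => T.card ≤ k).card : ℝ)
      = (A.powerset.filter fun T => T.card ≤ k).card * Real.exp (k * -σ) * Real.exp (σ * k) := by
        rw [mul_assoc, h4, mul_one]
    _ ≤ 2 ^ A.card * Real.exp (A.card * (-(σ / 2) + σ ^ 2 / 8)) * Real.exp (σ * k) := by gcongr
    _ = _ := by
        rw [mul_assoc, ← Real.exp_add]
        congr 2
        ring

theorem card_filter_superset_le_exp {m : ℕ} (L : Finset (Fin m)) {r : ℕ} (hr : L.card ≤ r) {σ : ℝ}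
    (hσ : 0 ≤ σ) :
    ((Finset.univ.filter fun S : Finset (Fin m) => L ⊆ S ∧ S.card ≤ r).card : ℝ) ≤
      2 ^ (m - L.card) *
        Real.exp (σ * (r - L.card) - (m - L.card) * (σ / 2 - σ ^ 2 / 8)) := by
  have hL : L.card ≤ m := by simpa using Finset.card_le_univ L
  have h1 : (Finset.univ.filter fun S : Finset (Fin m) => L ⊆ S ∧ S.card ≤ r).card ≤
      (Lᶜ.powerset.filter fun T => T.card ≤ r - L.card).card := by
    refine Finset.card_le_card_of_injOn (fun S => S \ L) ?_ ?_
    · intro S hS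
      obtain ⟨hLS, hSr⟩ := (Finset.mem_filter.1 hS).2
      refine Finset.mem_coe.2 (Finset.mem_filter.2 ⟨Finset.mem_powerset.2 ?_, ?_⟩)
      · intro i hi
        exact Finset.mem_compl.2 (Finset.mem_sdiff.1 hi).2
      · rw [Finset.card_sdiff_of_subset hLS]
        omega
    · intro S hS S' hS' h
      have h1 := (Finset.mem_filter.1 hS).2.1
      have h2 := (Finset.mem_filter.1 hS').2.1
      rw [← Finset.sdiff_union_of_subset h1, ← Finset.sdiff_union_of_subset h2]
      exact congrArg (· ∪ L) h
  have h2 := card_powerset_filter_le_exp Lᶜ (r - L.card) hσ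
  rw [Finset.card_compl, Fintype.card_fin, Nat.cast_sub hr, Nat.cast_sub hL] at h2
  exact (Nat.cast_le.2 h1).trans h2

theorem one_le_codeRate_reedMuller_add {m r : ℕ} (hr : r ≤ m) {σ : ℝ} (hσ : 0 ≤ σ) :
    1 ≤ codeRate (reedMuller m r) + Real.exp (σ * (m - r) - m * (σ / 2 - σ ^ 2 / 8)) := by
  have h1 : (Finset.univ.filter fun S : Finset (Fin m) => r < S.card).card ≤
      ((Finset.univ : Finset (Fin m)).powerset.filter fun T => T.card ≤ m - r).card := by
    refine Finset.card_le_card_of_injOn (fun S => Sᶜ) ?_ compl_injective.injOn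
    intro S hS
    have := (Finset.mem_filter.1 hS).2
    refine Finset.mem_coe.2 (Finset.mem_filter.2 ⟨Finset.mem_powerset.2 (Finset.subset_univ _), ?_⟩)
    rw [Finset.card_compl, Fintype.card_fin]
    omega
  have h2 := card_powerset_filter_le_exp (Finset.univ : Finset (Fin m)) (m - r) hσ
  rw [Finset.card_univ, Fintype.card_fin, Nat.cast_sub hr] at h2
  have h3 : (2 : ℝ) ^ m ≤ Module.finrank (ZMod 2) (reedMuller m r) +
      (Finset.univ.filter fun S : Finset (Fin m) => r < S.card).card := by
    exact_mod_cast two_pow_le_finrank_reedMuller_add m r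
  have h4 := (Nat.cast_le (α := ℝ).2 h1).trans h2
  have hN : (0 : ℝ) < 2 ^ m := by positivity
  rw [codeRate, Fintype.card_fun, ZMod.card, Fintype.card_fin, Nat.cast_pow, Nat.cast_ofNat,
    div_add' _ _ _ hN.ne', one_le_div hN]
  linarith

/-- A Reed–Muller code of rate bounded away from `1` has order at most about half the number of
variables. -/
theorem eventually_order_le {R ε : ℝ} (hR : R < 1) (hε : 0 < ε) :
    ∀ᶠ m : ℕ in atTop, ∀ r, codeRate (reedMuller m r) ≤ R → (r : ℝ) ≤ (1 / 2 + ε) * m := by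
  have h1 : Tendsto (fun m : ℕ => Real.exp (-(2 * ε ^ 2 * (m : ℝ)))) atTop (𝓝 0) :=
    Real.tendsto_exp_neg_atTop_nhds_zero.comp
      (tendsto_natCast_atTop_atTop.const_mul_atTop (by positivity))
  filter_upwards [h1.eventually (gt_mem_nhds (sub_pos.2 hR))] with m hm r hr
  by_contra! hlt
  have hm0 : (0 : ℝ) ≤ m := Nat.cast_nonneg m
  have hmono : ∀ r', r ≤ r' → codeRate (reedMuller m r) ≤ codeRate (reedMuller m r') := by
    intro r' h
    refine div_le_div_of_nonneg_right (Nat.cast_le.2 (Submodule.finrank_mono ?_)) (Nat.cast_nonneg _)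
    rw [reedMuller_eq_span, reedMuller_eq_span]
    exact Submodule.span_mono (Set.image_mono fun S (hS : _ ≤ _) => hS.trans h)
  rcases le_or_gt r m with h | h
  · have h2 := one_le_codeRate_reedMuller_add h (σ := 4 * ε) (by positivity)
    have h3 : Real.exp (4 * ε * (m - r) - m * (4 * ε / 2 - (4 * ε) ^ 2 / 8)) ≤
        Real.exp (-(2 * ε ^ 2 * (m : ℝ))) := by
      refine Real.exp_le_exp.2 ?_
      have := mul_lt_mul_of_pos_left hlt hε
      nlinarith
    linarith
  · have h2 : Module.finrank (ZMod 2) (reedMuller m r) = 2 ^ m := by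
      refine le_antisymm ?_ ?_
      · refine (Submodule.finrank_le _).trans_eq ?_
        simp
      · have h3 := two_pow_le_finrank_reedMuller_add m r
        rwa [Finset.card_eq_zero.2, add_zero] at h3
        refine Finset.filter_eq_empty_iff.2 fun S _ => ?_
        have : S.card ≤ m := by simpa using Finset.card_le_univ S
        omega
    have h4 : codeRate (reedMuller m r) = 1 := by
      rw [codeRate, h2]
      simp
    linarith

end BinomialTail

/-! ### Weight distribution of Reed–Muller codes at low weights. -/

section WeightDistribution

variable {m : ℕ}

/-- The number of codewords of Hamming weight `w`. -/
noncomputable def weightCount {ι : Type*} [Fintype ι] (C : Submodule (ZMod 2) (ι → ZMod 2)) (w : ℕ) :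
    ℕ := Nat.card {f : ι → ZMod 2 // f ∈ C ∧ hammingNorm f = w}

/-- More than `r` derivatives annihilate the code, yet at each point some choice of directions
reproduces the value of `f`. This is a minimum distance bound up to a constant factor. -/
theorem eq_zero_of_lowWeight (hm : 1 ≤ m) (L : Finset (Fin m)) {r : ℕ} (hr : r < L.card)
    {f : (Fin m → ZMod 2) → ZMod 2} (hf : f ∈ reedMuller m r)
    (hw : 2 ^ (L.card + 5) * hammingNorm f ≤ 2 ^ m) : f = 0 := by
  classical
  let _ : Fintype ((Fin m → ZMod 2) ≃ₗ[ZMod 2] (Fin m → ZMod 2)) := Fintype.ofFinite _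
  funext x
  have h1 := card_bad_le hm L hw x
  set bad := Finset.univ.filter fun A : (Fin m → ZMod 2) ≃ₗ[ZMod 2] (Fin m → ZMod 2) =>
      ∃ I ∈ L.powerset, I ≠ ∅ ∧ f (x + A fun i => if i ∈ I then 1 else 0) ≠ 0
  obtain ⟨A, hA⟩ : ∃ A, A ∉ bad := by
    by_contra! h
    have h2 : bad = Finset.univ := Finset.eq_univ_iff_forall.2 h
    have h3 : 0 < Fintype.card ((Fin m → ZMod 2) ≃ₗ[ZMod 2] (Fin m → ZMod 2)) := Fintype.card_pos
    rw [h2, Finset.card_univ] at h1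
    omega
  have h2 : iteratedDerivative L A f x = f x := by
    refine iteratedDerivative_eq_self (map_zero _) fun I hI hI0 => ?_
    by_contra hne
    exact hA (Finset.mem_filter.2 ⟨Finset.mem_univ _, I, hI, hI0, hne⟩)
  have h3 : derivativeSpan L r = ⊥ := by
    rw [derivativeSpan, Finset.filter_eq_empty_iff.2]
    · simp
    · intro S _ hS
      have := Finset.card_le_card hS.1
      omega
  have h4 := iteratedDerivative_mem L hf A
  rw [h3, Submodule.mem_bot] at h4
  have h5 := congrFun h4 (A.symm x)
  simp only [LinearEquiv.apply_symm_apply] at h5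
  rw [← h2, h5]
  rfl

theorem weightCount_lowWeight (hm : 1 ≤ m) (L : Finset (Fin m)) {r w : ℕ} (hw0 : 1 ≤ w)
    (hw : 2 ^ (L.card + 5) * w ≤ 2 ^ m) (hne : weightCount (reedMuller m r) w ≠ 0) :
    L.card ≤ r ∧ weightCount (reedMuller m r) w ≤ 2 ^ ((m * m +
      (Finset.univ.filter fun S : Finset (Fin m) => L ⊆ S ∧ S.card ≤ r).card) * (m + 1)) := by
  constructor
  · by_contra! h
    obtain ⟨⟨f, hf, hfw⟩⟩ := (Nat.card_ne_zero.1 hne).1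
    have := eq_zero_of_lowWeight hm L h hf (by rwa [hfw])
    rw [this, hammingNorm_zero] at hfw
    omega
  · refine (le_trans ?_ (card_lowWeight_le hm L r)).trans_eq (by rw [← pow_add, ← pow_mul])
    refine Nat.card_le_card_of_injective
      (fun f => ⟨f.1, f.2.1, by rw [f.2.2]; exact hw⟩) fun f g h => ?_
    exact Subtype.ext (Subtype.mk.inj h)

/-- The largest number of derivatives that weight `w` allows, so that 2^(m-l) is comparable to `w`.
-/
theorem exists_scale {w : ℕ} (hw0 : 1 ≤ w) (hw : 2 ^ 5 * w ≤ 2 ^ m) :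
    ∃ l, l ≤ m ∧ 2 ^ (l + 5) * w ≤ 2 ^ m ∧ 2 ^ m < 2 ^ (l + 6) * w := by
  have hex : ∃ l, 2 ^ m < 2 ^ (l + 6) * w :=
    ⟨m, by
      calc 2 ^ m < 2 ^ (m + 6) := Nat.pow_lt_pow_right (by norm_num) (by omega)
        _ ≤ 2 ^ (m + 6) * w := Nat.le_mul_of_pos_right _ hw0⟩
  have h1 := Nat.find_spec hex
  have h3 : 2 ^ (Nat.find hex + 5) * w ≤ 2 ^ m := by
    rcases Nat.eq_zero_or_pos (Nat.find hex) with h | h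
    · rw [h]; exact hw
    · have := Nat.find_min hex (m := Nat.find hex - 1) (by omega)
      rw [not_lt] at this
      rwa [show Nat.find hex + 5 = Nat.find hex - 1 + 6 by omega]
  refine ⟨Nat.find hex, ?_, h3, h1⟩
  have h4 : 2 ^ (Nat.find hex + 5) ≤ 2 ^ m := (Nat.le_mul_of_pos_right _ hw0).trans h3
  have := (Nat.pow_le_pow_iff_right (by norm_num : 1 < 2)).1 h4
  omega

/-- Low weight codewords of Reed–Muller codes of rate bounded away from `1` are rare. -/
theorem eventually_weightCount_le {R δ η : ℝ} (hR : R < 1) (hδ : 0 < δ) (hδ1 : δ ≤ 1)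
    (hη : 0 < η) :
    ∀ᶠ m : ℕ in atTop, ∀ r, codeRate (reedMuller m r) ≤ R → ∀ w : ℕ, 1 ≤ w →
      (w : ℝ) ≤ 2 ^ m * Real.exp (-(δ * m)) → weightCount (reedMuller m r) w ≠ 0 →
      (2 : ℝ) ^ ((m : ℝ) / 4) ≤ w ∧ (weightCount (reedMuller m r) w : ℝ) ≤ 2 ^ (η * w) := by
  have hlog : 0 < Real.log 2 / 4 := by have := Real.log_pos one_lt_two; positivity
  have t1 : Tendsto (fun m : ℕ => (m : ℝ) ^ 3 * Real.exp (-(Real.log 2 / 4 * (m : ℝ)))) atTop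
      (𝓝 0) := by
    have := (Real.tendsto_pow_mul_exp_neg_atTop_nhds_zero 3).comp
      ((tendsto_natCast_atTop_atTop (R := ℝ)).const_mul_atTop hlog)
    have h2 := this.const_mul ((Real.log 2 / 4)⁻¹ ^ 3)
    rw [mul_zero] at h2
    refine h2.congr fun m => ?_
    simp only [Function.comp]
    field_simp
  have t2 : Tendsto (fun m : ℕ => (m : ℝ) * Real.exp (-(δ ^ 2 / 4 * (m : ℝ)))) atTop (𝓝 0) := by
    have hd : 0 < δ ^ 2 / 4 := by positivity
    have := (Real.tendsto_pow_mul_exp_neg_atTop_nhds_zero 1).comp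
      ((tendsto_natCast_atTop_atTop (R := ℝ)).const_mul_atTop hd)
    have h2 := this.const_mul ((δ ^ 2 / 4)⁻¹)
    rw [mul_zero] at h2
    refine h2.congr fun m => ?_
    simp only [Function.comp]
    field_simp
  have t3 : Tendsto (fun m : ℕ => Real.exp (-(δ * (m : ℝ)))) atTop (𝓝 0) :=
    Real.tendsto_exp_neg_atTop_nhds_zero.comp (tendsto_natCast_atTop_atTop.const_mul_atTop hδ)
  have b1 : 0 < η / 4 := by positivity
  have b2 : 0 < η / (256 * Real.exp 3) := by positivity
  filter_upwards [eventually_order_le hR (show 0 < δ / 8 by positivity), eventually_ge_atTop 48,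
    t1.eventually (gt_mem_nhds b1), t2.eventually (gt_mem_nhds b2),
    t3.eventually (gt_mem_nhds (show (0 : ℝ) < 1 / 32 by norm_num))] with
    m hord hm48 h1 h2 h3 r hr w hw0 hw hne
  have hm48' : (48 : ℝ) ≤ m := by exact_mod_cast hm48
  have hr' := hord r hr
  have hw32 : 2 ^ 5 * w ≤ 2 ^ m := by
    have : (2 : ℝ) ^ 5 * w ≤ 2 ^ m := by
      have : (2 : ℝ) ^ m * Real.exp (-(δ * m)) ≤ 2 ^ m * (1 / 32) := by gcongr
      linarith
    exact_mod_cast this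
  obtain ⟨l, hlm, hl5, hl6⟩ := exists_scale hw0 hw32
  obtain ⟨L, -, hL⟩ := Finset.exists_subset_card_eq (s := (Finset.univ : Finset (Fin m)))
    (n := l) (by simpa using hlm)
  subst hL
  obtain ⟨hlr, hcount⟩ := weightCount_lowWeight (by omega) L hw0 hl5 hne
  have hw0' : (1 : ℝ) ≤ w := by exact_mod_cast hw0
  have hl6' : (2 : ℝ) ^ m < 2 ^ (L.card + 6) * w := by exact_mod_cast hl6
  have hlr' : (L.card : ℝ) ≤ r := by exact_mod_cast hlr
  have hδl : δ * m ≤ L.card + 6 := by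
    have e1 : Real.exp (δ * m) * w ≤ 2 ^ m := by
      rw [Real.exp_neg, ← div_eq_mul_inv, le_div_iff₀ (Real.exp_pos _)] at hw
      linarith
    have e2 : Real.exp (δ * m) < 2 ^ (L.card + 6) :=
      lt_of_mul_lt_mul_right (e1.trans_lt hl6') (by linarith)
    have e3 : (2 : ℝ) ^ (L.card + 6) ≤ Real.exp 1 ^ (L.card + 6) :=
      pow_le_pow_left₀ (by norm_num) (by linarith [Real.add_one_le_exp 1]) _
    rw [← Real.exp_nat_mul, mul_one] at e3
    have e4 := Real.exp_lt_exp.1 (e2.trans_le e3)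
    push_cast at e4
    exact e4.le
  -- Here l ≤ r ≤ 5m/8, so w > 2^(3m/8 - 6), and `m ≥ 48` absorbs the 6.
  have hwbig : (2 : ℝ) ^ ((m : ℝ) / 4) ≤ w := by
    have e1 : (2 : ℝ) ^ (m : ℝ) < 2 ^ ((L.card : ℝ) + 6) * w := by
      have : (2 : ℝ) ^ ((L.card : ℝ) + 6) = 2 ^ (L.card + 6) := by
        rw [← Real.rpow_natCast]; push_cast; rfl
      rw [this, Real.rpow_natCast]
      exact hl6'
    have e2 : (2 : ℝ) ^ (m : ℝ) =
        2 ^ ((L.card : ℝ) + 6) * 2 ^ ((m : ℝ) - ((L.card : ℝ) + 6)) := by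
      rw [← Real.rpow_add two_pos]; congr 1; ring
    rw [e2] at e1
    have e3 := lt_of_mul_lt_mul_left e1 (by positivity)
    refine le_trans ?_ e3.le
    refine Real.rpow_le_rpow_of_exponent_le one_le_two ?_
    have : δ / 8 * m ≤ 1 / 8 * m := by gcongr
    linarith
  refine ⟨hwbig, ?_⟩
  set B := (Finset.univ.filter fun S : Finset (Fin m) => L ⊆ S ∧ S.card ≤ r).card
  -- Chernoff with `σ = δ`: since r ≤ (1/2 + δ/8)m and l ≥ δm - 6, the bound r - l on the remaining
  -- degree is well below (m - l)/2, and the exponent is at most 3δ - δ²m/4.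
  have hB : (B : ℝ) ≤ 64 * w * (Real.exp 3 * Real.exp (-(δ ^ 2 / 4 * m))) := by
    have e1 := card_filter_superset_le_exp L hlr hδ.le
    have e2 : (2 : ℝ) ^ (m - L.card) ≤ 64 * w := by
      have : (2 : ℝ) ^ m = 2 ^ L.card * 2 ^ (m - L.card) := by
        rw [← pow_add]; congr 1; omega
      rw [this, pow_add, mul_assoc] at hl6'
      have := lt_of_mul_lt_mul_left hl6' (by positivity)
      linarith
    refine e1.trans (mul_le_mul e2 ?_ (Real.exp_pos _).le (by positivity))
    rw [← Real.exp_add]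
    refine Real.exp_le_exp.2 ?_
    have f1 := mul_le_mul_of_nonneg_left hr' hδ.le
    have f2 := mul_le_mul_of_nonneg_left hδl hδ.le
    have f3 : 0 ≤ δ ^ 2 * (L.card : ℝ) := by positivity
    nlinarith
  have hcount' : (weightCount (reedMuller m r) w : ℝ) ≤
      2 ^ (((m : ℝ) * m + B) * (m + 1)) := by
    have : (weightCount (reedMuller m r) w : ℝ) ≤ 2 ^ ((m * m + B) * (m + 1)) := by
      exact_mod_cast hcount
    rw [← Real.rpow_natCast] at this
    push_cast at this
    exact this
  refine hcount'.trans (Real.rpow_le_rpow_of_exponent_le one_le_two ?_)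
  have hm1 : (m : ℝ) + 1 ≤ 2 * m := by linarith
  have g1 : (m : ℝ) * m * (m + 1) ≤ η / 2 * w := by
    have e1 : (m : ℝ) ^ 3 ≤ η / 4 * w := by
      have e2 : Real.exp (-(Real.log 2 / 4 * (m : ℝ))) * 2 ^ ((m : ℝ) / 4) = 1 := by
        rw [Real.rpow_def_of_pos two_pos, ← Real.exp_add, ← Real.exp_zero]
        congr 1
        ring
      calc (m : ℝ) ^ 3 = (m : ℝ) ^ 3 * Real.exp (-(Real.log 2 / 4 * (m : ℝ))) *
            2 ^ ((m : ℝ) / 4) := by rw [mul_assoc, e2, mul_one]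
        _ ≤ η / 4 * w := by gcongr
    have e3 : (m : ℝ) * m * (m + 1) ≤ m * m * (2 * m) := by gcongr
    linarith [show (m : ℝ) * m * (2 * m) = 2 * m ^ 3 by ring]
  have g2 : (B : ℝ) * (m + 1) ≤ η / 2 * w := by
    have e4 : (m : ℝ) * Real.exp (-(δ ^ 2 / 4 * (m : ℝ))) * (256 * Real.exp 3) ≤ η :=
      ((lt_div_iff₀ (by positivity)).1 h2).le
    calc (B : ℝ) * (m + 1)
        ≤ 64 * w * (Real.exp 3 * Real.exp (-(δ ^ 2 / 4 * m))) * (2 * m) := by gcongr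
      _ = (m * Real.exp (-(δ ^ 2 / 4 * (m : ℝ))) * (256 * Real.exp 3)) * (w / 2) := by ring
      _ ≤ η * (w / 2) := by gcongr
      _ = _ := by ring
  linarith

end WeightDistribution

/-! ### Combining the two bounds on the weight enumerator. -/

section CutoffRate

theorem weightEnum_eq_sum_weightCount {ι : Type*} [Fintype ι] [DecidableEq ι]
    (C : Submodule (ZMod 2) (ι → ZMod 2)) (z : ℝ) :
    weightEnum C (fun _ => z) =
      ∑ w ∈ Finset.range (Fintype.card ι + 1), (weightCount C w : ℝ) * z ^ w := by
  classical
  have h : ∀ c : C, ∏ i, (if (c : ι → ZMod 2) i = 0 then 1 else z) =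
      z ^ hammingNorm (c : ι → ZMod 2) := by
    intro c
    rw [Finset.prod_ite, Finset.prod_const_one, one_mul, Finset.prod_const]
    rfl
  rw [weightEnum]
  simp_rw [h]
  rw [← Finset.sum_fiberwise_of_maps_to (t := Finset.range (Fintype.card ι + 1))
    (g := fun c : C => hammingNorm (c : ι → ZMod 2))
    (fun c _ => Finset.mem_range.2 (Nat.lt_succ_of_le hammingNorm_le_card_fintype))]
  refine Finset.sum_congr rfl fun w _ => ?_
  rw [Finset.sum_congr rfl fun c hc => by rw [(Finset.mem_filter.1 hc).2], Finset.sum_const,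
    nsmul_eq_mul]
  congr 2
  rw [weightCount, ← Fintype.card_subtype, ← Nat.card_eq_fintype_card]
  exact Nat.card_congr (Equiv.subtypeSubtypeEquivSubtypeInter (· ∈ C)
    (fun f : ι → ZMod 2 => hammingNorm f = w))

theorem weightCount_zero_le {ι : Type*} [Fintype ι] (C : Submodule (ZMod 2) (ι → ZMod 2)) :
    weightCount C 0 ≤ 1 := by
  refine Finite.card_le_one_iff_subsingleton.2 ⟨fun f g => Subtype.ext ?_⟩
  rw [hammingNorm_eq_zero.1 f.2.2, hammingNorm_eq_zero.1 g.2.2]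

theorem eventually_weightEnum_le {R e₁ e₂ : ℝ} (h0 : 0 < e₁) (h12 : e₁ < e₂) (h2 : e₂ < 1)
    (hR : R < 1 - e₂) :
    ∃ c, 0 < c ∧ c ≤ 1 ∧ ∀ᶠ m : ℕ in atTop, ∀ r, codeRate (reedMuller m r) ≤ R →
      weightEnum (reedMuller m r) (fun _ => 2 ^ e₁ - 1) ≤
        2 ^ ((2 : ℝ) ^ m * Real.exp (-(c * m))) := by
  have h1e : 0 < 1 - e₂ := by linarith
  set η := 1 - R / (1 - e₂) with hη
  have hη0 : 0 < η := by
    rw [hη, sub_pos, div_lt_one h1e]; exact hR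
  have hRη : R = (1 - η) * (1 - e₂) := by rw [hη]; field_simp; ring
  set κ := min e₁ (1 - e₂)
  have hκ : 0 < κ := lt_min h0 h1e
  -- `a` is chosen so that the level `k = m / a` meets the size condition of the sharp threshold,
  -- using `k ^ 3 ≤ 8 ^ k`; `k` is then still linear in `m`.
  obtain ⟨a, ha⟩ : ∃ a : ℕ, 8 * (κ / 2)⁻¹ ^ 4 < 2 ^ a := pow_unbounded_of_one_lt _ one_lt_two
  have ha1 : 1 ≤ a := by
    by_contra! h
    have : a = 0 := by omega
    rw [this, pow_zero] at ha
    have h5 : κ ≤ 1 / 2 := by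
      have h6 : κ ≤ e₁ := min_le_left _ _
      have h7 : κ ≤ 1 - e₂ := min_le_right _ _
      linarith
    have h6 : 1 ≤ (κ / 2)⁻¹ := (one_le_inv₀ (by positivity)).2 (by linarith)
    have h7 : 1 ≤ (κ / 2)⁻¹ ^ 4 := one_le_pow₀ h6
    linarith
  have ha0 : (0 : ℝ) < a := by exact_mod_cast ha1
  refine ⟨min 1 (η * (e₂ - e₁) / (8 * a)), lt_min one_pos ?_, min_le_left _ _, ?_⟩
  · have : 0 < e₂ - e₁ := by linarith
    positivity
  set c := min 1 (η * (e₂ - e₁) / (8 * a))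
  filter_upwards [eventually_ge_atTop (2 * a)] with m hm r hr
  obtain ⟨k, hk⟩ : ∃ k, k = m / a := ⟨_, rfl⟩
  have hk1 : 1 ≤ k := by
    rw [hk, Nat.one_le_div_iff ha1]; omega
  have hka : a * k ≤ m := by rw [hk]; exact Nat.mul_div_le m a
  have hmk : m ≤ 2 * a * k := by
    have h3 : m < a * (k + 1) := by rw [hk]; exact Nat.lt_mul_div_succ m ha1
    have h4 : a * (k + 1) ≤ a * (2 * k) := Nat.mul_le_mul_left _ (by omega)
    rw [mul_comm 2 a, mul_assoc]
    omega
  have hcard : Fintype.card (Fin m → ZMod 2) = 2 ^ m := by simp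
  have hbig : ((κ / 2)⁻¹ ^ (2 * k)) ^ 2 * (k : ℝ) ^ 3 ≤ Fintype.card (Fin m → ZMod 2) := by
    rw [hcard]
    have h3 : (k : ℝ) ^ 3 ≤ 8 ^ k := by
      have : (k : ℝ) ≤ 2 ^ k := by exact_mod_cast Nat.lt_two_pow_self.le
      calc (k : ℝ) ^ 3 ≤ (2 ^ k) ^ 3 := by gcongr
        _ = 8 ^ k := by rw [← pow_mul, mul_comm, pow_mul]; norm_num
    calc ((κ / 2)⁻¹ ^ (2 * k)) ^ 2 * (k : ℝ) ^ 3
        ≤ ((κ / 2)⁻¹ ^ (2 * k)) ^ 2 * 8 ^ k := by gcongr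
      _ = (8 * (κ / 2)⁻¹ ^ 4) ^ k := by
          rw [mul_pow, ← pow_mul, ← pow_mul]; ring
      _ ≤ (2 ^ a) ^ k := by gcongr
      _ = 2 ^ (a * k) := by rw [pow_mul]
      _ ≤ 2 ^ m := pow_le_pow_right₀ one_le_two hka
      _ = _ := by push_cast; rfl
  have hfail := biasedExp_erasureFail_le hκ (min_le_left _ _) h12.le (min_le_right _ _)
    (reedMuller_transitive r) (reedMuller_doubly_transitive r) (hr.trans_eq hRη) 0
    (by
      rw [hcard]
      calc 2 = 2 ^ 1 := rfl
        _ ≤ 2 ^ m := Nat.pow_le_pow_right (by norm_num) (by omega)) hk1 hbig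
  have hdim := biasedExp_erasureDim_le (reedMuller_transitive r) (0 : Fin m → ZMod 2) h0.le
    (by linarith)
  have h2e : (1 : ℝ) ≤ 2 ^ e₁ := Real.one_le_rpow one_le_two h0.le
  have h2e' : (2 : ℝ) ^ e₁ ≤ 2 := by
    calc (2 : ℝ) ^ e₁ ≤ 2 ^ (1 : ℝ) := Real.rpow_le_rpow_of_exponent_le one_le_two (by linarith)
      _ = 2 := Real.rpow_one 2
  have henum := logb_weightEnum_le_biasedExp (reedMuller m r) (z := 2 ^ e₁ - 1) (e := e₁)
    (by linarith) (by linarith)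
    (by rw [add_sub_cancel, Real.logb_rpow two_pos (by norm_num)])
  have hpos : 0 < weightEnum (reedMuller m r) (fun _ => 2 ^ e₁ - 1) :=
    zero_lt_one.trans_le (one_le_weightEnum _ fun _ => by linarith)
  rw [← Real.logb_le_iff_le_rpow one_lt_two hpos]
  refine henum.trans (hdim.trans ?_)
  rw [hcard]
  push_cast
  refine mul_le_mul_of_nonneg_left (hfail.trans (Real.exp_le_exp.2 ?_)) (by positivity)
  rw [neg_le_neg_iff]
  have hmk' : (m : ℝ) ≤ 2 * a * k := by exact_mod_cast hmk
  have he : 0 < e₂ - e₁ := by linarith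
  calc c * m ≤ η * (e₂ - e₁) / (8 * a) * (2 * a * k) := by
        refine mul_le_mul (min_le_right _ _) hmk' (Nat.cast_nonneg _) (by positivity)
    _ = k * η / 4 * (e₂ - e₁) := by field_simp; ring

theorem eventually_weightEnum_sub_one_le {R e₁ e₂ z ε : ℝ} (h0 : 0 < e₁) (h12 : e₁ < e₂)
    (h2 : e₂ < 1) (hR : R < 1 - e₂) (hz0 : 0 < z) (hz : z < 2 ^ e₁ - 1) (hε : 0 < ε) :
    ∀ᶠ m : ℕ in atTop, ∀ r, codeRate (reedMuller m r) ≤ R →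
      weightEnum (reedMuller m r) (fun _ => z) - 1 ≤ ε := by
  obtain ⟨c, hc0, hc1, hc⟩ := eventually_weightEnum_le h0 h12 h2 hR
  have h2e' : (2 : ℝ) ^ e₁ ≤ 2 := by
    calc (2 : ℝ) ^ e₁ ≤ 2 ^ (1 : ℝ) := Real.rpow_le_rpow_of_exponent_le one_le_two (by linarith)
      _ = 2 := Real.rpow_one 2
  set z₁ := (2 : ℝ) ^ e₁ - 1
  have hz1 : 0 < z₁ := hz0.trans hz
  have hzlt : z < 1 := by linarith
  -- Any `y` strictly between `z` and 1 would do; `η` is the growth rate of the weight counts for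
  -- which light words contribute at most `y ^ w`.
  obtain ⟨y, hy⟩ : ∃ y, y = (1 + z) / 2 := ⟨_, rfl⟩
  have hy0 : 0 < y := by rw [hy]; linarith
  have hy1 : y < 1 := by rw [hy]; linarith
  have hyz : z < y := by rw [hy]; linarith
  set η := Real.logb 2 (y / z) with hη
  have hη0 : 0 < η := Real.logb_pos one_lt_two ((one_lt_div hz0).2 hyz)
  have h2η : (2 : ℝ) ^ η * z = y := by
    rw [hη, Real.rpow_logb two_pos (by norm_num) (by positivity)]
    field_simp
  set β := Real.log (z₁ / z)
  have hβ : 0 < β := Real.log_pos ((one_lt_div hz0).2 hz)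
  have hβe : Real.exp (-β) * z₁ = z := by
    rw [Real.exp_neg, Real.exp_log (by positivity)]
    field_simp
  have hlog2 := Real.log_two_gt_d9
  have t1 : Tendsto (fun m : ℕ => y ^ ⌈(2 : ℝ) ^ ((m : ℝ) / 4)⌉₊ / (1 - y)) atTop (𝓝 0) := by
    have h3 : Tendsto (fun m : ℕ => ⌈(2 : ℝ) ^ ((m : ℝ) / 4)⌉₊) atTop atTop := by
      refine tendsto_nat_ceil_atTop.comp ((tendsto_rpow_atTop_of_base_gt_one 2 one_lt_two).comp ?_)
      exact (tendsto_natCast_atTop_atTop (R := ℝ)).atTop_div_const (by norm_num)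
    have := ((tendsto_pow_atTop_nhds_zero_of_lt_one hy0.le hy1).comp h3).div_const (1 - y)
    simpa using this
  have t2 : Tendsto (fun m : ℕ => Real.exp (-(β / 2 * ((Real.log 2 - 1 / 2) * (m : ℝ))))) atTop
      (𝓝 0) := by
    refine Real.tendsto_exp_neg_atTop_nhds_zero.comp ?_
    refine Tendsto.const_mul_atTop (by positivity) ?_
    exact tendsto_natCast_atTop_atTop.const_mul_atTop (by linarith)
  have t3 : Tendsto (fun m : ℕ => Real.exp (-(c / 2 * (m : ℝ)))) atTop (𝓝 0) :=
    Real.tendsto_exp_neg_atTop_nhds_zero.comp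
      (tendsto_natCast_atTop_atTop.const_mul_atTop (by positivity))
  have hR1 : R < 1 := by linarith
  filter_upwards [hc, eventually_weightCount_le hR1 (show 0 < c / 2 by positivity)
    (by linarith) hη0, t1.eventually (gt_mem_nhds (half_pos hε)),
    t2.eventually (gt_mem_nhds (half_pos hε)),
    t3.eventually (gt_mem_nhds (half_pos hβ))] with m hm1 hm2 hm3 hm4 hm5 r hr
  have hZ := hm1 r hr
  have hlow := hm2 r hr
  set C := reedMuller m r
  set n := ⌈(2 : ℝ) ^ ((m : ℝ) / 4)⌉₊
  set E := Real.exp (-(c / 2 * (m : ℝ)))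
  have hE : 0 < E := Real.exp_pos _
  set w₀ := (2 : ℝ) ^ m * E
  have hcard : Fintype.card (Fin m → ZMod 2) = 2 ^ m := by simp
  rw [weightEnum_eq_sum_weightCount, hcard] at hZ ⊢
  -- The three summands account for the zero word, for weights up to `w₀`, and for heavier words,
  -- where passing from `z₁` to `z` gains `exp (-β * w)`.
  have hterm : ∀ w ∈ Finset.range (2 ^ m + 1), (weightCount C w : ℝ) * z ^ w ≤
      (if w = 0 then 1 else 0) + (if n ≤ w then y ^ w else 0) +
        (weightCount C w : ℝ) * z₁ ^ w * Real.exp (-(β * w₀)) := by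
    intro w _
    have a1 : (0 : ℝ) ≤ if w = 0 then 1 else 0 := by split_ifs <;> norm_num
    have a2 : 0 ≤ if n ≤ w then y ^ w else 0 := by split_ifs <;> positivity
    have a3 : 0 ≤ (weightCount C w : ℝ) * z₁ ^ w * Real.exp (-(β * w₀)) := by positivity
    rcases Nat.eq_zero_or_pos w with hw | hw
    · have : (weightCount C w : ℝ) ≤ 1 := by rw [hw]; exact_mod_cast weightCount_zero_le C
      have h5 : (weightCount C w : ℝ) * z ^ w ≤ 1 := by rw [hw] at this ⊢; simpa using this
      rw [if_pos hw]
      linarith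
    rcases le_or_gt (w : ℝ) w₀ with hle | hgt
    · by_cases hA : weightCount C w = 0
      · have h5 : (weightCount C w : ℝ) * z ^ w = 0 := by rw [hA]; simp
        linarith
      · obtain ⟨b1, b2⟩ := hlow w hw hle hA
        have hn : n ≤ w := Nat.ceil_le.2 b1
        have h5 : (weightCount C w : ℝ) * z ^ w ≤ y ^ w := by
          rw [← h2η, mul_pow, ← Real.rpow_mul_natCast two_pos.le]
          gcongr
        rw [if_pos hn]
        linarith
    · have h5 : z ^ w ≤ z₁ ^ w * Real.exp (-(β * w₀)) := by
        rw [← hβe, mul_pow, ← Real.exp_nat_mul, mul_comm]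
        have : Real.exp (w * -β) ≤ Real.exp (-(β * w₀)) := by
          refine Real.exp_le_exp.2 ?_
          have := mul_le_mul_of_nonneg_left hgt.le hβ.le
          linarith
        gcongr
      have h6 := mul_le_mul_of_nonneg_left h5 (Nat.cast_nonneg (α := ℝ) (weightCount C w))
      linarith
  have hsum := Finset.sum_le_sum hterm
  rw [Finset.sum_add_distrib, Finset.sum_add_distrib, ← Finset.sum_mul] at hsum
  have s1 : ∑ w ∈ Finset.range (2 ^ m + 1), (if w = 0 then (1 : ℝ) else 0) = 1 := by
    simp
  have s2 : ∑ w ∈ Finset.range (2 ^ m + 1), (if n ≤ w then y ^ w else 0) ≤ ε / 2 := by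
    rw [← Finset.sum_filter]
    have : (Finset.range (2 ^ m + 1)).filter (fun w => n ≤ w) = Finset.Ico n (2 ^ m + 1) := by
      ext w
      simp [and_comm]
    rw [this]
    exact (geom_sum_Ico_le_of_lt_one hy0.le hy1).trans hm3.le
  -- The enumerator at `z₁` is at most `2 ^ (w₀ * E)` with `E → 0`, negligible against `exp (-β *
  -- w₀)`. The bound `c ≤ 1` makes `w₀` grow.
  have s3 : (∑ w ∈ Finset.range (2 ^ m + 1), (weightCount C w : ℝ) * z₁ ^ w) *
      Real.exp (-(β * w₀)) ≤ ε / 2 := by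
    refine le_trans ?_ hm4.le
    have hEE : Real.exp (-(c * m)) = E * E := by
      rw [← Real.exp_add]; congr 1; ring
    calc _ ≤ 2 ^ ((2 : ℝ) ^ m * Real.exp (-(c * m))) * Real.exp (-(β * w₀)) := by gcongr
      _ = Real.exp (w₀ * (Real.log 2 * E - β)) := by
          rw [Real.rpow_def_of_pos two_pos, ← Real.exp_add, hEE]
          congr 1
          simp only [w₀]
          ring
      _ ≤ _ := by
          refine Real.exp_le_exp.2 ?_
          have f1 : Real.log 2 * E ≤ β / 2 := by
            have : Real.log 2 * E ≤ 1 * E := by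
              have := Real.log_two_lt_d9
              gcongr
              linarith
            linarith
          have f2 : (Real.log 2 - 1 / 2) * m ≤ w₀ := by
            have f3 : w₀ = Real.exp ((Real.log 2 - c / 2) * m) := by
              simp only [w₀, E]
              rw [← Real.rpow_natCast, Real.rpow_def_of_pos two_pos, ← Real.exp_add]
              congr 1
              ring
            rw [f3]
            have f4 : (Real.log 2 - 1 / 2) * m ≤ (Real.log 2 - c / 2) * m := by gcongr
            have := Real.add_one_le_exp ((Real.log 2 - c / 2) * m)
            linarith
          have f5 : 0 ≤ w₀ := by positivity
          have f6 : w₀ * (Real.log 2 * E - β) ≤ w₀ * (-(β / 2)) := by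
            refine mul_le_mul_of_nonneg_left ?_ f5
            linarith
          have f7 := mul_le_mul_of_nonneg_left f2 (half_pos hβ).le
          linarith
  linarith

theorem codeRate_le_one {ι : Type*} [Fintype ι] (C : Submodule (ZMod 2) (ι → ZMod 2)) :
    codeRate C ≤ 1 := by
  refine div_le_one_of_le₀ (Nat.cast_le.2 ?_) (Nat.cast_nonneg _)
  refine (Submodule.finrank_le C).trans_eq ?_
  simp

end CutoffRate

/-! ### The main theorem. -/

theorem proposition1p4 (R p : ℝ) (hR0 : 0 < R) (hR1 : R < 1) (hp0 : 0 ≤ p) (hp1 : p ≤ 1)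
    (hRp : R < 1 - Real.logb 2 (1 + √(4 * p * (1 - p))))
    (m r : ℕ → ℕ) (hm : Tendsto m atTop atTop)
    (hrate : limsup (fun n => codeRate (reedMuller (m n) (r n))) atTop ≤ R) :
    ∃ D : ∀ n, ((Fin (m n) → ZMod 2) → ZMod 2) → reedMuller (m n) (r n),
      (∀ n, IsMLDecoder p (reedMuller (m n) (r n)) (D n)) ∧
      Tendsto (fun n => blockErrorProb p (reedMuller (m n) (r n)) (D n)) atTop (𝓝 0) := by
  choose D hD using fun n => exists_isMLDecoder (reedMuller (m n) (r n)) p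
  refine ⟨D, hD, ?_⟩
  set z := √(4 * p * (1 - p))
  have hz0 : 0 ≤ z := Real.sqrt_nonneg _
  set e := Real.logb 2 (1 + z) with he
  have he0 : 0 ≤ e := Real.logb_nonneg one_lt_two (by linarith)
  have h2e : (2 : ℝ) ^ e = 1 + z := Real.rpow_logb two_pos (by norm_num) (by linarith)
  -- A quarter of the gap leaves room for e < e + g < e + 2g < 1 - (R + g): two erasure densities
  -- and a slack for the limsup.
  obtain ⟨g, hg⟩ : ∃ g, g = (1 - R - e) / 4 := ⟨_, rfl⟩
  have hg0 : 0 < g := by rw [hg]; linarith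
  have hz1 : z < 2 ^ (e + g) - 1 := by
    have := Real.rpow_lt_rpow_of_exponent_lt one_lt_two (show e < e + g by linarith)
    linarith
  -- Replacing `z` by a slightly larger `z'` ensures positivity also when p is 0 or 1.
  obtain ⟨z', hz', hz'1⟩ := exists_between hz1
  have hev : ∀ᶠ n in atTop, codeRate (reedMuller (m n) (r n)) < R + g := by
    refine eventually_lt_of_limsup_lt (hrate.trans_lt (by linarith)) ?_
    exact isBoundedUnder_of ⟨1, fun n => codeRate_le_one _⟩
  have hupper : ∀ ε > 0, ∀ᶠ n in atTop,
      blockErrorProb p (reedMuller (m n) (r n)) (D n) ≤ ε := by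
    intro ε hε
    have hE := hm.eventually (eventually_weightEnum_sub_one_le (R := R + g) (e₁ := e + g)
      (e₂ := e + 2 * g) (by linarith) (by linarith) (by linarith) (by linarith)
      (hz0.trans_lt hz') hz'1 hε)
    filter_upwards [hE, hev] with n hn hr
    refine (blockErrorProb_le _ hp0 hp1 (hD n)).trans (le_trans ?_ (hn (r n) hr.le))
    exact sub_le_sub_right (weightEnum_mono _ (fun _ => hz0) fun _ => hz'.le) 1
  rw [Metric.tendsto_nhds]
  intro ε hε
  filter_upwards [hupper (ε / 2) (half_pos hε)] with n hn
  rw [Real.dist_eq, sub_zero, abs_of_nonneg (blockErrorProb_nonneg _ hp0 hp1 _)]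
  linarith
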